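/- Let $\Bbbk$ be an algebraically closed field of characteristic zero, let $t,a,b,k,p,q\in\Bbbk$ with $t\neq 0$, and let $V$ be the vector space with basis $x_1,x_2,x_3$ and braiding $c$ of type $\mathfrak R_{1,6}$, given by (writing $x_ix_j$ for $x_i\otimes x_j$) $$\begin{aligned} c(x_1x_1)&=t\,x_1x_1, & c(x_2x_1)&=t\,(x_1x_2+a\,x_1x_1), & c(x_3x_1)&=t\,(x_1x_3+p\,x_1x_1),\\ c(x_1x_2)&=t\,(x_2x_1-a\,x_1x_1), & c(x_1x_3)&=t\,(x_3x_1-p\,x_1x_1), && \end{aligned}$$ $$\begin{aligned} c(x_2x_2)&=t\,(x_2x_2+b\,x_2x_1-b\,x_1x_2-ab\,x_1x_1),\\ c(x_3x_2)&=t\,(x_2x_3+p\,x_2x_1-a\,x_1x_3-(2pa+k)\,x_1x_1),\\ c(x_2x_3)&=t\,(x_3x_2+a\,x_3x_1-p\,x_1x_2+k\,x_1x_1),\\ c(x_3x_3)&=t\,(x_3x_3+q\,x_3x_1-q\,x_1x_3-pq\,x_1x_1). \end{aligned}$$ Let $\mathcal J(V)=\bigoplus_{n\ge 2}\mathcal J_n(V)\subset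 T(V)$, where $\mathcal J_n(V)\subset V^{\otimes n}$ is the kernel of the quantum symmetrizer $Q_n=\sum_{\sigma\in\mathbb S_n}\rho_n(M(\sigma))$; here $\rho_n$ is the representation of the braid group $\mathbb B_n$ on $V^{\otimes n}$ induced by $c$ and $M:\mathbb S_n\to\mathbb B_n$ is the Matsumoto section. Let $\mathfrak B(V)=T(V)/\mathcal J(V)$ be the Nichols algebra of $(V,c)$. 1. If $t^2\neq 1$, then $\mathfrak B(V)$ has no quadratic relations, i.e. $\mathcal J_2(V)=0$. 2. If $t=-1$, then $\mathcal J(V)$ is the two-sided ideal of $T(V)$ generated by $$x_2x_1+x_1x_2,\quad x_3x_1+x_1x_3,\quad x_3x_2+x_2x_3-a\,x_1x_3-p\,x_1x_2,\quad x_1^2,\quad x_2^2-b\,x_1x_2,\quad x_3^2-q\,x_1x_3;$$ the set $B_0=\{x_1^{a_1}x_2^{a_2}x_3^{a_3}: 0\le a_i<2\}$ is a basis of $\mathfrak B(V)$; $\dim\mathfrak B(V)=8$ and $\operatorname{GKdim}\mathfrak B(V)=0$. 3. If $t=1$, then $\mathcal J(V)$ is the two-sided ideal of $T(V)$ generated by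 $$x_2x_1-x_1x_2-a\,x_1^2,\quad x_3x_1-x_1x_3-p\,x_1^2,\quad x_3x_2-x_2x_3+a\,x_1x_3-p\,x_1x_2+(k+pa)\,x_1^2;$$ the set $B_3=\{x_1^{a_1}x_2^{a_2}x_3^{a_3}: a_i\ge 0\}$ is a (PBW) basis of $\mathfrak B(V)$ and $\operatorname{GKdim}\mathfrak B(V)=3$. -/

import Mathlib

open Module Filter

noncomputable section

namespace NicholsR16

/-! ### Matsumoto section of the symmetric group

Reduced expressions in the adjacent transpositions `s_i = (i  i+1)`, with positions counted from `0`. -/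

/-- The adjacent transposition `s_i` of `Fin n` (the identity if `i + 1` is out of range). -/
def adjSwap (n i : ℕ) : Equiv.Perm (Fin n) :=
  if h : i + 1 < n then Equiv.swap ⟨i, by omega⟩ ⟨i + 1, h⟩ else 1

/-- The permutation `τ` with `σ = s_{m-1} ⋯ s_0 (1 × τ)`, `m = σ 0`. -/
def tailPerm {n : ℕ} (σ : Equiv.Perm (Fin (n+1))) : Equiv.Perm (Fin n) :=
  (Equiv.Perm.decomposeFin (Fin.cycleRange (σ 0) * σ)).2

/-- A reduced word of `σ`: write `σ = s_{m-1} ⋯ s_1 s_0 (1 × τ)`, where `m = σ 0` and `1 × τ` fixes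
`0` and acts as `τ` on the remaining points; then continue with `τ`. -/
def reducedWord : (n : ℕ) → Equiv.Perm (Fin n) → List ℕ
  | 0, _ => []
  | n + 1, σ =>
      (List.range (σ 0 : ℕ)).reverse ++
        (reducedWord n (tailPerm σ)).map (· + 1)

/-- The number of inversions of `σ`, i.e. its Coxeter length. -/
def inversions {n : ℕ} (σ : Equiv.Perm (Fin n)) : ℕ :=
  (Finset.univ.filter fun x : Fin n × Fin n => x.1 < x.2 ∧ σ x.2 < σ x.1).card

theorem cycleRange_mul_eq {n : ℕ} (σ : Equiv.Perm (Fin (n+1))) :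
    Fin.cycleRange (σ 0) * σ = Equiv.Perm.decomposeFin.symm (0, tailPerm σ) := by
  set ρ := Fin.cycleRange (σ 0) * σ with hρ
  have h0 : ρ 0 = 0 := by simp [hρ]
  obtain ⟨⟨p, e⟩, hpe⟩ := Equiv.Perm.decomposeFin.symm.surjective ρ
  have hp : p = 0 := by
    rw [← hpe] at h0
    simpa using h0
  subst hp
  have : tailPerm σ = e := by
    unfold tailPerm
    rw [← hρ, ← hpe, Equiv.apply_symm_apply]
  rw [this, hpe]

theorem apply_succ {n : ℕ} (σ : Equiv.Perm (Fin (n+1))) (j : Fin n) :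
    σ j.succ = (σ 0).succAbove (tailPerm σ j) := by
  have h := congrArg (fun ρ : Equiv.Perm (Fin (n+1)) => ρ j.succ) (cycleRange_mul_eq σ)
  simp only [Equiv.Perm.mul_apply, Equiv.Perm.decomposeFin_symm_apply_succ, Equiv.swap_self,
    Equiv.refl_apply] at h
  rw [← Fin.cycleRange_symm_succ, ← h, Equiv.symm_apply_apply]

theorem prod_range_adjSwap (n m : ℕ) (hm : m < n + 1) :
    (((List.range m).reverse).map (adjSwap (n+1))).prod = (Fin.cycleRange ⟨m, hm⟩)⁻¹ := by
  induction m with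
  | zero => 
    simp
  | succ m ih =>
    rw [List.range_succ, List.reverse_append, List.reverse_singleton, List.singleton_append,
      List.map_cons, List.prod_cons, ih (by omega), ← inv_inj, mul_inv_rev, inv_inv, inv_inv]
    ext x
    simp only [adjSwap, hm, dif_pos, Equiv.swap_inv, Equiv.Perm.mul_apply]
    rcases lt_trichotomy x.val (m+1) with h | h | h
    · rw [Fin.coe_cycleRange_of_lt (i := x) (j := ⟨m+1,hm⟩) h]
      rcases Nat.lt_or_ge x.val m with h' | h'
      · rw [Equiv.swap_apply_of_ne_of_ne, Fin.coe_cycleRange_of_lt (by exact h')] <;>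
          simp [Fin.ext_iff] <;> omega
      · obtain rfl : m = x.val := by omega
        rw [show (⟨x.val, by omega⟩ : Fin (n + 1)) = x from rfl]
        rw [Equiv.swap_apply_left, Fin.cycleRange_of_gt (by simp [Fin.lt_def])]
    · have : x = ⟨m+1, hm⟩ := Fin.ext h
      subst this
      simp
    · rw [Equiv.swap_apply_of_ne_of_ne, Fin.cycleRange_of_gt, Fin.cycleRange_of_gt] <;>
          simp [Fin.ext_iff, Fin.lt_def] <;> omega

theorem adjSwap_succ (n i : ℕ) :
    adjSwap (n+1) (i+1) = Equiv.Perm.decomposeFin.symm (0, adjSwap n i) := by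
  unfold adjSwap
  split_ifs with h1 h2 h2
  · ext x
    refine Fin.cases ?_ (fun y => ?_) x
    · simp [Equiv.swap_apply_def, Fin.ext_iff]
    · simp only [Equiv.Perm.decomposeFin_symm_apply_succ, Equiv.swap_self, Equiv.refl_apply]
      rw [(Fin.succ_injective n).map_swap]; rfl
  · omega
  · omega
  · simp; rfl

theorem decomposeFin_symm_mul {n : ℕ} (e f : Equiv.Perm (Fin n)) :
    Equiv.Perm.decomposeFin.symm ((0 : Fin (n+1)), e * f) =
      Equiv.Perm.decomposeFin.symm (0, e) * Equiv.Perm.decomposeFin.symm (0, f) := by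
  ext x
  refine Fin.cases ?_ (fun y => ?_) x <;> simp

/-- The reduced word of `σ` is an expression of `σ`. -/
theorem prod_reducedWord (n : ℕ) (σ : Equiv.Perm (Fin n)) :
    ((reducedWord n σ).map (adjSwap n)).prod = σ := by
  induction n with
  | zero => exact Subsingleton.elim _ _
  | succ n ih =>
    have key : ∀ l : List ℕ, (((l.map (· + 1)).map (adjSwap (n+1))).prod) =
        Equiv.Perm.decomposeFin.symm (0, (l.map (adjSwap n)).prod) := by
      intro l
      induction l with
      | nil => simp; rfl
      | cons i l ihl =>
        simp only [List.map_cons, List.prod_cons, decomposeFin_symm_mul, ihl, adjSwap_succ]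
    rw [reducedWord, List.map_append, List.prod_append, key, ih, prod_range_adjSwap n _ (σ 0).2]
    change _ * Equiv.Perm.decomposeFin.symm (0, tailPerm σ) = σ
    rw [← cycleRange_mul_eq, inv_mul_cancel_left]

/-- The reduced word of `σ` has minimal length: as many letters as `σ` has inversions. -/
theorem length_reducedWord (n : ℕ) (σ : Equiv.Perm (Fin n)) :
    (reducedWord n σ).length = inversions σ := by
  induction n with
  | zero => simp [reducedWord, inversions]
  | succ n ih =>
    rw [reducedWord, List.length_append, List.length_map, ih, List.length_reverse,
      List.length_range]
    have hc : ∀ p : Fin (n+1), (Finset.univ.filter fun j : Fin n => p.succAbove j < p).card = p := by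
      intro p
      have : (Finset.univ.filter fun j : Fin n => p.succAbove j < p) =
          Finset.univ.filter fun j : Fin n => j.val < p.val := by
        ext j; simp only [Finset.mem_filter, Finset.mem_univ, true_and, Fin.succAbove_lt_iff_castSucc_lt]
        rfl
      rw [this, Fin.card_filter_val_lt]; omega
    have hc' : (Finset.univ.filter fun j : Fin n => σ j.succ < σ 0).card = σ 0 := by
      rw [← hc (σ 0)]
      refine Finset.card_bij (fun j _ => tailPerm σ j) ?_ ?_ ?_
      · intro j hj; simpa [apply_succ] using hj
      · intro i _ j _ h; exact (tailPerm σ).injective h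
      · intro j hj
        exact ⟨(tailPerm σ).symm j, by simpa [apply_succ] using hj, by simp⟩
    unfold inversions
    simp only [Finset.card_filter, Fintype.sum_prod_type, Fin.sum_univ_succ] at hc' ⊢
    simp only [apply_succ, Fin.succAbove_lt_succAbove_iff] at hc' ⊢
    simp [hc']

/-! ### The Nichols algebra of a braided vector space with a basis

`V` is the vector space with basis `x_i`, `i : X`, and the tensor algebra `T(V)` is the free algebra
on the `x_i`. The braiding is given by its structure constants:
`c (x_i ⊗ x_j) = ∑_{k, l} r i j k l x_k ⊗ x_l`. -/

section Nichols

variable {K : Type*} [Field K] {X : Type*} [Fintype X]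

/-- The basis element `x_{i_1} x_{i_2} ⋯ x_{i_n}` of `T(V)`. -/
def wordMonomial (K : Type*) [Field K] {X : Type*} (w : List X) : FreeAlgebra K X :=
  (w.map (FreeAlgebra.ι K)).prod

/-- `id^{⊗ i} ⊗ c ⊗ id^{⊗ (n - i - 2)}` applied to a word of length `n`, for `i + 2 ≤ n`
(words that are too short are left alone). -/
def braidWord (r : X → X → X → X → K) : ℕ → List X → FreeAlgebra K X
  | 0, x :: y :: w =>
      ∑ k : X, ∑ l : X,
        r x y k l • (FreeAlgebra.ι K k * FreeAlgebra.ι K l * wordMonomial K w)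
  | i + 1, x :: w => FreeAlgebra.ι K x * braidWord r i w
  | _, w => wordMonomial K w

/-- The operator `id^{⊗ i} ⊗ c ⊗ id ⊗ ⋯ ⊗ id` on `T(V)`, by which the `i`-th generator of the braid
group acts. -/
def braidOp (r : X → X → X → X → K) (i : ℕ) : End K (FreeAlgebra K X) :=
  (FreeAlgebra.basisFreeMonoid K X).constr K fun w => braidWord r i w.toList

/-- The quantum symmetrizer `Q_n = ∑_{σ ∈ S_n} ρ_n (M σ)`, where `M σ` is the Matsumoto lift of `σ`
to the braid group (the product of the braid generators along a reduced word of `σ`). It is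
meant to be applied to `T^n(V)`. -/
def quantumSymmetrizer (r : X → X → X → X → K) (n : ℕ) : End K (FreeAlgebra K X) :=
  ∑ σ : Equiv.Perm (Fin n), ((reducedWord n σ).map (braidOp r)).prod

/-- `T^n(V)`, the homogeneous component of degree `n` of `T(V)`. -/
def tensorDegree (K : Type*) [Field K] (X : Type*) (n : ℕ) : Submodule K (FreeAlgebra K X) :=
  Submodule.span K {m | ∃ w : List X, w.length = n ∧ m = wordMonomial K w}

/-- `J_n(V)`, the kernel of `Q_n` on `T^n(V)`: the relations of degree `n` of the Nichols algebra. -/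
def nicholsRelations (r : X → X → X → X → K) (n : ℕ) : Submodule K (FreeAlgebra K X) :=
  tensorDegree K X n ⊓ LinearMap.ker (quantumSymmetrizer r n)

/-- `J(V) = ⨁_{n ≥ 2} J_n(V)`, as a subspace of `T(V)`. -/
def nicholsSubspace (r : X → X → X → X → K) : Submodule K (FreeAlgebra K X) :=
  ⨆ n : ℕ, ⨆ _ : 2 ≤ n, nicholsRelations r n

/-- The two-sided ideal generated by `J(V)`. When `r` is a braiding, `J(V)` is already an ideal, so
this is `J(V)` itself. -/
def nicholsIdeal (r : X → X → X → X → K) : TwoSidedIdeal (FreeAlgebra K X) :=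
  TwoSidedIdeal.span (nicholsSubspace r : Set (FreeAlgebra K X))

/-- The Nichols algebra `B(V) = T(V) / J(V)`. -/
abbrev NicholsAlgebra (r : X → X → X → X → K) : Type _ :=
  (nicholsIdeal r).ringCon.Quotient

/-- The image of the basis vector `x_i` of `V` in `B(V)`. -/
def gen (r : X → X → X → X → K) (i : X) : NicholsAlgebra r :=
  (nicholsIdeal r).ringCon.mk' (FreeAlgebra.ι K i)

end Nichols

/-- The Gelfand–Kirillov dimension of an algebra `A`: the supremum over all finite-dimensional
subspaces `W` of `limsup_n log_n dim (W^0 + W^1 + ⋯ + W^n)`. -/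
def GKdim (K A : Type*) [Field K] [Ring A] [Algebra K A] : EReal :=
  ⨆ W : {W : Submodule K A // W.FG},
    limsup (fun n : ℕ =>
      ((Real.log (finrank K (⨆ i : Fin (n + 1), W.1 ^ (i : ℕ) : Submodule K A)) / Real.log n : ℝ)
        : EReal)) atTop

/-! ### The braiding of type `R_{1,6}` -/

section R16

variable {K : Type*} [Field K]

/-- The solution `R_{1,6}` of the quantum Yang-Baxter equation. The rows are indexed by
`11, 12, 13, 21, 22, 23, 31, 32, 33` and the columns by `11, 21, 31, 12, 22, 32, 13, 23, 33`. -/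
def matrixR16 (t a b k p q : K) : Matrix (Fin (3 * 3)) (Fin (3 * 3)) K :=
  !![t, t*a, t*p, -(t*a), -(t*a*b), -(t*(2*p*a+k)), -(t*p), t*k,    -(t*p*q);
     0, t,   0,   0,      -(t*b),   0,              0,      -(t*p), 0;
     0, 0,   t,   0,      0,        -(t*a),         0,      0,      -(t*q);
     0, 0,   0,   t,      t*b,      t*p,            0,      0,      0;
     0, 0,   0,   0,      t,        0,              0,      0,      0;
     0, 0,   0,   0,      0,        t,              0,      0,      0;
     0, 0,   0,   0,      0,        0,              t,      t*a,    t*q;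
     0, 0,   0,   0,      0,        0,              0,      t,      0;
     0, 0,   0,   0,      0,        0,              0,      0,      t]

/-- The structure constants of the braiding of `R_{1,6}`: the coefficient of `x_m ⊗ x_l` in
`c (x_i ⊗ x_j)` is the entry of the matrix in row `ml` and column `ij`. -/
def braidingR16 (t a b k p q : K) (i j m l : Fin 3) : K :=
  matrixR16 t a b k p q (finProdFinEquiv (m, l)) (finProdFinEquiv (j, i))

/-- The generator `x_1` of `T(V)`. -/
def x₁ (K : Type*) [Field K] : FreeAlgebra K (Fin 3) := FreeAlgebra.ι K 0

/-- The generator `x_2` of `T(V)`. -/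
def x₂ (K : Type*) [Field K] : FreeAlgebra K (Fin 3) := FreeAlgebra.ι K 1

/-- The generator `x_3` of `T(V)`. -/
def x₃ (K : Type*) [Field K] : FreeAlgebra K (Fin 3) := FreeAlgebra.ι K 2

/-- The defining relations for `t = -1`. -/
def relationsNeg (a b p q : K) : Set (FreeAlgebra K (Fin 3)) :=
  {x₂ K * x₁ K + x₁ K * x₂ K,
   x₃ K * x₁ K + x₁ K * x₃ K,
   x₃ K * x₂ K + x₂ K * x₃ K - a • (x₁ K * x₃ K) - p • (x₁ K * x₂ K),
   x₁ K ^ 2,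
   x₂ K ^ 2 - b • (x₁ K * x₂ K),
   x₃ K ^ 2 - q • (x₁ K * x₃ K)}

/-- The defining relations for `t = 1`. -/
def relationsPos (a k p : K) : Set (FreeAlgebra K (Fin 3)) :=
  {x₂ K * x₁ K - x₁ K * x₂ K - a • x₁ K ^ 2,
   x₃ K * x₁ K - x₁ K * x₃ K - p • x₁ K ^ 2,
   x₃ K * x₂ K - x₂ K * x₃ K + a • (x₁ K * x₃ K) - p • (x₁ K * x₂ K) + (k + p * a) • x₁ K ^ 2}

end R16

end NicholsR16

end

/-!
A quadratic tensor is killed by `Q_2 = 1 + c` exactly when `c v = -v`, while `c² = t²` on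
`V ⊗ V`; hence there are no quadratic relations unless `t² = 1`.

For `t = ±1` the listed elements are quadratic relations, so the ideal `I` they generate consists of
relations. Conversely, `T(V) / I` is braided commutative: `x_i x_j` is the image of `c (x_i ⊗ x_j)`
in the quotient. So every braid generator acts trivially modulo `I`, and `Q_n v` is congruent to
`n! v`. In characteristic zero `Q_n v = 0` therefore forces `v ∈ I`.

The quadratic relations straighten every product into the ordered monomials. These are linearly
independent because the relations are satisfied by explicit operators: on an eight-dimensional space
for `t = -1`, and by differential operators on `K[X, Y, Z]` for `t = 1`, where applying the ordered
monomials to `1` gives a family that is unitriangular for the `X`-adic filtration.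
-/

noncomputable section

namespace NicholsR16

section Symmetrizer

variable {R : Type*} [Semiring R] {s : ℕ → R} {n : ℕ}

/-- The symmetrizer `∑ σ, s_{i_1} ⋯ s_{i_l}` of a sequence `s` in a ring, where `i_1 ⋯ i_l` is the
reduced word of `σ ∈ S_n`. The quantum symmetrizer is the case of the braid operators. -/
def symmetrizer (s : ℕ → R) (n : ℕ) : R :=
  ∑ σ : Equiv.Perm (Fin n), ((reducedWord n σ).map s).prod

/-- The descending product `s (m-1) * ⋯ * s 1 * s 0`, which represents the cycle moving `0` to `m`
in reduced words. -/
def descProd (s : ℕ → R) (m : ℕ) : R := ((List.range m).reverse.map s).prod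

@[simp]
theorem descProd_zero (s : ℕ → R) : descProd s 0 = 1 := by simp [descProd]

theorem descProd_succ (s : ℕ → R) (m : ℕ) : descProd s (m + 1) = s m * descProd s m := by
  simp [descProd, List.range_succ]

theorem descProd_shift_mul (s : ℕ → R) (m : ℕ) :
    descProd (fun i => s (i + 1)) m * s 0 = descProd s (m + 1) := by
  induction m with
  | zero => simp [descProd_succ]
  | succ m ih => rw [descProd_succ, mul_assoc, ih, ← descProd_succ]

/-- A permutation is encoded by its value at `0` and its tail, as in `reducedWord`. -/
def headTailEquiv (n : ℕ) : Equiv.Perm (Fin (n + 1)) ≃ Fin (n + 1) × Equiv.Perm (Fin n) :=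
  Equiv.ofBijective (fun σ => (σ 0, tailPerm σ)) <| by
    refine (Fintype.bijective_iff_injective_and_card _).2 ⟨fun σ τ h => ?_, ?_⟩
    · obtain ⟨head_eq, tail_eq⟩ := Prod.mk.inj h
      ext x
      refine Fin.cases ?_ (fun y => ?_) x
      · rw [head_eq]
      · rw [apply_succ, apply_succ, head_eq, tail_eq]
    · simp [Fintype.card_perm, Nat.factorial_succ]

@[simp]
theorem symmetrizer_zero (s : ℕ → R) : symmetrizer s 0 = 1 := by
  simp [symmetrizer, reducedWord]

theorem symmetrizer_succ (s : ℕ → R) (n : ℕ) :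
    symmetrizer s (n + 1) =
      (∑ m ∈ Finset.range (n + 1), descProd s m) * symmetrizer (fun i => s (i + 1)) n := by
  rw [Finset.sum_range, symmetrizer, symmetrizer, Finset.sum_mul_sum, ← Fintype.sum_prod_type',
    ← (headTailEquiv n).sum_comp]
  refine Finset.sum_congr rfl fun σ _ => ?_
  simp [headTailEquiv, reducedWord, descProd, Function.comp_def]

theorem descProd_commute {x : R} (m : ℕ) (h : ∀ i < m, Commute (s i) x) :
    Commute (descProd s m) x := by
  induction m with
  | zero => simp
  | succ m ih =>
    rw [descProd_succ]
    exact (h m m.lt_succ_self).mul_left (ih fun i hi => h i (by omega))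

theorem symmetrizer_commute {x : R} (n : ℕ) (h : ∀ i, i + 1 < n → Commute (s i) x) :
    Commute (symmetrizer s n) x := by
  induction n generalizing s with
  | zero => simp
  | succ n ih =>
    rw [symmetrizer_succ]
    refine Commute.mul_left (Commute.sum_left _ _ _ fun m hm => ?_)
      (ih fun i hi => h (i + 1) (by omega))
    have := Finset.mem_range.1 hm
    exact descProd_commute m fun i hi => h i (by omega)

/-- The relations of the braid group `B_n` on `s 0, …, s (n-2)`. -/
structure BraidRelations (s : ℕ → R) (n : ℕ) : Prop where
  braid : ∀ i, i + 2 < n → s i * s (i + 1) * s i = s (i + 1) * s i * s (i + 1)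
  comm : ∀ i j, i + 2 ≤ j → j + 1 < n → Commute (s i) (s j)

namespace BraidRelations

theorem shift (h : BraidRelations s (n + 1)) : BraidRelations (fun i => s (i + 1)) n where
  braid i hi := h.braid (i + 1) (by omega)
  comm i j hi hj := h.comm (i + 1) (j + 1) (by omega) (by omega)

theorem mul_descProd (h : BraidRelations s n) {m j : ℕ} (hm : m < j) (hj : j + 1 < n) :
    s m * descProd s (j + 1) = descProd s (j + 1) * s (m + 1) := by
  induction j, hm using Nat.le_induction with
  | base =>
    have hcomm : Commute (descProd s m) (s (m + 1)) :=
      descProd_commute m fun i hi => h.comm i (m + 1) (by omega) (by omega)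
    calc s m * descProd s (m + 1 + 1)
        = s m * s (m + 1) * s m * descProd s m := by simp only [descProd_succ, mul_assoc]
      _ = s (m + 1) * s m * (s (m + 1) * descProd s m) := by
        rw [h.braid m (by omega), mul_assoc]
      _ = descProd s (m + 1 + 1) * s (m + 1) := by
        rw [← hcomm.eq]; simp only [descProd_succ, mul_assoc]
  | succ j hmj ih =>
    rw [descProd_succ, ← mul_assoc, (h.comm m (j + 1) (by omega) (by omega)).eq, mul_assoc,
      ih (by omega), mul_assoc]

theorem descProd_mul_descProd (h : BraidRelations s n) {m j : ℕ} (hm : m ≤ j) (hj : j + 1 < n) :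
    descProd s m * descProd s (j + 1) =
      descProd s (j + 1) * descProd (fun i => s (i + 1)) m := by
  induction m with
  | zero => simp
  | succ m ih =>
    rw [descProd_succ, mul_assoc, ih (by omega), ← mul_assoc, h.mul_descProd (by omega) hj,
      descProd_succ (fun i => s (i + 1)) m, mul_assoc]

theorem sum_descProd_mul_sum (h : BraidRelations s n) {l : ℕ} (hl : l < n) :
    (∑ m ∈ Finset.range (l + 1), descProd s m) *
        ∑ j ∈ Finset.range l, descProd (fun i => s (i + 1)) j =
      (∑ j ∈ Finset.range l, (∑ m ∈ Finset.range (j + 1), descProd s m) *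
        descProd (fun i => s (i + 1)) j) * (1 + s 0) := by
  induction l with
  | zero => simp
  | succ l ih =>
    have swap : (∑ m ∈ Finset.range (l + 1), descProd s m) * descProd (fun i => s (i + 1)) l * s 0 =
        descProd s (l + 1) * ∑ j ∈ Finset.range (l + 1), descProd (fun i => s (i + 1)) j := by
      rw [mul_assoc, descProd_shift_mul, Finset.sum_mul, Finset.mul_sum]
      exact Finset.sum_congr rfl fun m hm =>
        h.descProd_mul_descProd (Nat.lt_succ_iff.1 (Finset.mem_range.1 hm)) hl
    calc
      _ = (∑ m ∈ Finset.range (l + 1), descProd s m) *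
            (∑ j ∈ Finset.range l, descProd (fun i => s (i + 1)) j +
              descProd (fun i => s (i + 1)) l) +
          (∑ m ∈ Finset.range (l + 1), descProd s m) * descProd (fun i => s (i + 1)) l * s 0 := by
        rw [Finset.sum_range_succ _ (l + 1), add_mul, ← swap,
          Finset.sum_range_succ (descProd fun i => s (i + 1))]
      _ = _ := by
        conv_rhs => rw [Finset.sum_range_succ, add_mul, ← ih (by omega), mul_add, mul_one]
        rw [mul_add, add_assoc]

/-- The factor `T` is the sum over the minimal representatives of the cosets modulo `s_i`. -/
theorem exists_symmetrizer_eq_mul (h : BraidRelations s n) {i : ℕ} (hi : i + 1 < n) :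
    ∃ T, symmetrizer s n = T * (1 + s i) := by
  induction n generalizing s i with
  | zero => omega
  | succ n ih =>
    cases i with
    | succ i =>
      obtain ⟨T, hT⟩ := ih h.shift (i := i) (by omega)
      exact ⟨(∑ m ∈ Finset.range (n + 1), descProd s m) * T, by
        rw [symmetrizer_succ, hT, mul_assoc]⟩
    | zero =>
      obtain ⟨n, rfl⟩ : ∃ k, n = k + 1 := ⟨n - 1, by omega⟩
      have hcomm : Commute (symmetrizer (fun i => s (i + 1 + 1)) n) (1 + s 0) :=
        (Commute.one_right _).add_right <|
          symmetrizer_commute n fun i hi => (h.comm 0 (i + 2) (by omega) (by omega)).symm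
      rw [symmetrizer_succ, symmetrizer_succ, ← mul_assoc, h.sum_descProd_mul_sum (by omega),
        mul_assoc, ← hcomm.eq, ← mul_assoc]
      exact ⟨_, rfl⟩

end BraidRelations

end Symmetrizer

section BraidOperators

open FreeAlgebra (ι)

variable {K : Type*} [Field K] {X : Type*} {M : Type*} [AddCommGroup M] [Module K M]

@[simp]
theorem wordMonomial_nil : wordMonomial K ([] : List X) = 1 := rfl

@[simp]
theorem wordMonomial_cons (x : X) (w : List X) :
    wordMonomial K (x :: w) = ι K x * wordMonomial K w := by
  simp [wordMonomial]

@[simp]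
theorem wordMonomial_append (v w : List X) :
    wordMonomial K (v ++ w) = wordMonomial K v * wordMonomial K w := by
  simp [wordMonomial]

theorem basisFreeMonoid_apply (w : FreeMonoid X) :
    FreeAlgebra.basisFreeMonoid K X w = wordMonomial K w.toList := by
  simp [FreeAlgebra.basisFreeMonoid, wordMonomial, FreeAlgebra.equivMonoidAlgebraFreeMonoid,
    FreeMonoid.lift_apply]

theorem linearMap_ext_wordMonomial {f g : FreeAlgebra K X →ₗ[K] M}
    (h : ∀ w, f (wordMonomial K w) = g (wordMonomial K w)) : f = g :=
  (FreeAlgebra.basisFreeMonoid K X).ext fun w => by simpa [basisFreeMonoid_apply] using h w.toList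

theorem wordMonomial_mem (w : List X) : wordMonomial K w ∈ tensorDegree K X w.length :=
  Submodule.subset_span ⟨w, rfl, rfl⟩

theorem iSup_tensorDegree : ⨆ n, tensorDegree K X n = ⊤ := by
  rw [eq_top_iff, ← (FreeAlgebra.basisFreeMonoid K X).span_eq, Submodule.span_le]
  rintro _ ⟨w, rfl⟩
  rw [basisFreeMonoid_apply]
  exact Submodule.mem_iSup_of_mem _ (wordMonomial_mem _)

theorem tensorDegree_mul_tensorDegree (m n : ℕ) :
    tensorDegree K X m * tensorDegree K X n = tensorDegree K X (m + n) := by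
  rw [tensorDegree, tensorDegree, Submodule.span_mul_span]
  congr 1
  ext u
  constructor
  · rintro ⟨_, ⟨v, rfl, rfl⟩, _, ⟨w, rfl, rfl⟩, rfl⟩
    exact ⟨v ++ w, by simp⟩
  · rintro ⟨w, hw, rfl⟩
    refine ⟨_, ⟨w.take m, by simp [hw], rfl⟩, _, ⟨w.drop m, by simp [hw], rfl⟩, ?_⟩
    simp only [← wordMonomial_append, List.take_append_drop]

theorem mul_mem_tensorDegree {m n : ℕ} {u v : FreeAlgebra K X} (hu : u ∈ tensorDegree K X m)
    (hv : v ∈ tensorDegree K X n) : u * v ∈ tensorDegree K X (m + n) :=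
  tensorDegree_mul_tensorDegree (K := K) (X := X) m n ▸ Submodule.mul_mem_mul hu hv

theorem eq_of_mem_tensorDegree {f g : FreeAlgebra K X →ₗ[K] M} {n : ℕ}
    (h : ∀ w : List X, w.length = n → f (wordMonomial K w) = g (wordMonomial K w))
    {v : FreeAlgebra K X} (hv : v ∈ tensorDegree K X n) : f v = g v := by
  refine LinearMap.eqOn_span ?_ hv
  rintro _ ⟨w, hw, rfl⟩
  exact h w hw

theorem eq_of_mem_tensorDegree_add {f g : FreeAlgebra K X →ₗ[K] M} {m n : ℕ}
    (h : ∀ u ∈ tensorDegree K X m, ∀ v ∈ tensorDegree K X n, f (u * v) = g (u * v))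
    {w : FreeAlgebra K X} (hw : w ∈ tensorDegree K X (m + n)) : f w = g w := by
  rw [← tensorDegree_mul_tensorDegree] at hw
  induction hw using Submodule.mul_induction_on' with
  | mem_mul_mem u hu v hv => exact h u hu v hv
  | add v _ w _ hv hw => rw [map_add, map_add, hv, hw]

variable [Fintype X] (r : X → X → X → X → K)

@[simp]
theorem braidOp_wordMonomial (i : ℕ) (w : List X) :
    braidOp r i (wordMonomial K w) = braidWord r i w := by
  have := (FreeAlgebra.basisFreeMonoid K X).constr_basis K
    (fun w => braidWord r i w.toList) (FreeMonoid.ofList w)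
  rwa [basisFreeMonoid_apply] at this

theorem braidOp_zero_ι_mul_ι (x y : X) :
    braidOp r 0 (ι K x * ι K y) = ∑ k, ∑ l, r x y k l • (ι K k * ι K l) := by
  simpa [braidWord] using braidOp_wordMonomial r 0 [x, y]

theorem braidWord_mem (i : ℕ) (w : List X) :
    braidWord r i w ∈ tensorDegree K X w.length := by
  fun_induction braidWord r i w with
  | case1 x y w =>
    refine sum_mem fun k _ => sum_mem fun l _ => Submodule.smul_mem _ _ ?_
    simpa [mul_assoc] using wordMonomial_mem (K := K) (k :: l :: w)
  | case2 i x w ih =>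
    rw [List.length_cons, add_comm]
    exact mul_mem_tensorDegree (by simpa using wordMonomial_mem (K := K) [x]) ih
  | case3 => exact wordMonomial_mem _

theorem braidOp_mem (i : ℕ) {n : ℕ} {u : FreeAlgebra K X} (hu : u ∈ tensorDegree K X n) :
    braidOp r i u ∈ tensorDegree K X n := by
  refine Submodule.span_le (p := (tensorDegree K X n).comap (braidOp r i)) |>.2 ?_ hu
  rintro _ ⟨w, rfl, rfl⟩
  simpa using braidWord_mem r i w

theorem braidWord_append_left (i : ℕ) (w w' : List X) :
    braidWord r (w.length + i) (w ++ w') = wordMonomial K w * braidWord r i w' := by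
  induction w with
  | nil => simp
  | cons x w ih => simp [Nat.succ_add, braidWord, ih, mul_assoc]

theorem braidWord_append_right {i : ℕ} {w : List X} (hi : i + 1 < w.length) (w' : List X) :
    braidWord r i (w ++ w') = braidWord r i w * wordMonomial K w' := by
  induction i generalizing w with
  | zero =>
    match w, hi with
    | x :: y :: w, _ => simp [braidWord, Finset.sum_mul, mul_assoc]
  | succ i ih =>
    obtain ⟨x, w, rfl⟩ := List.exists_cons_of_length_pos (by omega : 0 < w.length)
    simp [braidWord, ih (w := w) (by simpa using hi), mul_assoc]

theorem braidOp_mul_left {m : ℕ} (i : ℕ) {u : FreeAlgebra K X} (hu : u ∈ tensorDegree K X m)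
    (v : FreeAlgebra K X) : braidOp r (m + i) (u * v) = u * braidOp r i v := by
  refine eq_of_mem_tensorDegree (f := braidOp r (m + i) ∘ₗ LinearMap.mulRight K v)
    (g := LinearMap.mulRight K (braidOp r i v)) ?_ hu
  rintro w rfl
  have on_words : braidOp r (w.length + i) ∘ₗ LinearMap.mulLeft K (wordMonomial K w) =
      LinearMap.mulLeft K (wordMonomial K w) ∘ₗ braidOp r i :=
    linearMap_ext_wordMonomial fun w' => by
      simp [← wordMonomial_append, braidWord_append_left]
  exact LinearMap.congr_fun on_words v

theorem braidOp_mul_right {i n : ℕ} (hi : i + 1 < n) {u : FreeAlgebra K X}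
    (hu : u ∈ tensorDegree K X n) (v : FreeAlgebra K X) :
    braidOp r i (u * v) = braidOp r i u * v := by
  refine eq_of_mem_tensorDegree (f := braidOp r i ∘ₗ LinearMap.mulRight K v)
    (g := LinearMap.mulRight K v ∘ₗ braidOp r i) ?_ hu
  rintro w rfl
  have on_words : braidOp r i ∘ₗ LinearMap.mulLeft K (wordMonomial K w) =
      LinearMap.mulLeft K (braidWord r i w) :=
    linearMap_ext_wordMonomial fun w' => by
      simp [← wordMonomial_append, braidWord_append_right r hi]
  simpa using LinearMap.congr_fun on_words v

/-- The action of the `i`-th braid generator on `T^n(V)`. -/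
def braidEnd (n i : ℕ) : End K (tensorDegree K X n) :=
  (braidOp r i).restrict fun _ => braidOp_mem r i

@[simp]
theorem coe_braidEnd (n i : ℕ) (v : tensorDegree K X n) :
    (braidEnd r n i v : FreeAlgebra K X) = braidOp r i v := rfl

theorem coe_prod_braidEnd (n : ℕ) (l : List ℕ) (v : tensorDegree K X n) :
    ((l.map (braidEnd r n)).prod v : FreeAlgebra K X) = (l.map (braidOp r)).prod v := by
  induction l with
  | nil => simp
  | cons i l ih => simp [ih]

theorem coe_symmetrizer_braidEnd (n : ℕ) (v : tensorDegree K X n) :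
    (symmetrizer (braidEnd r n) n v : FreeAlgebra K X) = quantumSymmetrizer r n v := by
  simp [symmetrizer, quantumSymmetrizer, LinearMap.sum_apply, coe_prod_braidEnd]

/-- The braid equation `(c ⊗ id)(id ⊗ c)(c ⊗ id) = (id ⊗ c)(c ⊗ id)(id ⊗ c)` on `V ⊗ V ⊗ V`.
Invertibility of `c` is not part of it. -/
def IsBraiding : Prop :=
  ∀ v ∈ tensorDegree K X 3,
    braidOp r 0 (braidOp r 1 (braidOp r 0 v)) = braidOp r 1 (braidOp r 0 (braidOp r 1 v))

variable {r}

theorem IsBraiding.braidOp_braid (h : IsBraiding r) {i n : ℕ} (hi : i + 2 < n)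
    {v : FreeAlgebra K X} (hv : v ∈ tensorDegree K X n) :
    braidOp r i (braidOp r (i + 1) (braidOp r i v)) =
      braidOp r (i + 1) (braidOp r i (braidOp r (i + 1) v)) := by
  obtain ⟨m, rfl⟩ : ∃ m, n = i + 3 + m := ⟨n - i - 3, by omega⟩
  refine eq_of_mem_tensorDegree_add (f := braidOp r i * braidOp r (i + 1) * braidOp r i)
    (g := braidOp r (i + 1) * braidOp r i * braidOp r (i + 1)) (fun v hv w _ => ?_) hv
  have inner : braidOp r i (braidOp r (i + 1) (braidOp r i v)) =
      braidOp r (i + 1) (braidOp r i (braidOp r (i + 1) v)) := by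
    refine eq_of_mem_tensorDegree_add (f := braidOp r i * braidOp r (i + 1) * braidOp r i)
      (g := braidOp r (i + 1) * braidOp r i * braidOp r (i + 1)) (fun u hu s hs => ?_) hv
    have at_zero (z) : braidOp r i (u * z) = u * braidOp r 0 z := braidOp_mul_left r 0 hu z
    have at_one (z) : braidOp r (i + 1) (u * z) = u * braidOp r 1 z := braidOp_mul_left r 1 hu z
    simp only [Module.End.mul_apply, at_zero, at_one, h s hs]
  have hi : i + 1 < i + 3 := by omega
  have hi' : i + 1 + 1 < i + 3 := by omega
  simp (maxDischargeDepth := 3) [braidOp_mul_right r hi, braidOp_mul_right r hi', braidOp_mem, hv,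
    inner]

variable (r) in
theorem braidOp_comm {i j n : ℕ} (hij : i + 2 ≤ j) (hj : j + 1 < n) {v : FreeAlgebra K X}
    (hv : v ∈ tensorDegree K X n) :
    braidOp r i (braidOp r j v) = braidOp r j (braidOp r i v) := by
  obtain ⟨l, rfl⟩ : ∃ l, n = i + 2 + l := ⟨n - (i + 2), by omega⟩
  obtain ⟨m, rfl⟩ : ∃ m, j = i + 2 + m := ⟨j - (i + 2), by omega⟩
  refine eq_of_mem_tensorDegree_add (f := braidOp r i * braidOp r (i + 2 + m))
    (g := braidOp r (i + 2 + m) * braidOp r i) (fun u hu w _ => ?_) hv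
  have hi : i + 1 < i + 2 := by omega
  simp [braidOp_mul_left r m hu, braidOp_mul_right r hi hu,
    braidOp_mul_left r m (braidOp_mem r i hu)]

theorem IsBraiding.braidRelations (h : IsBraiding r) (n : ℕ) :
    BraidRelations (braidEnd r n) n where
  braid _ hi := LinearMap.ext fun v => Subtype.ext (h.braidOp_braid hi v.2)
  comm _ _ hij hj := LinearMap.ext fun v => Subtype.ext (braidOp_comm r hij hj v.2)

theorem IsBraiding.quantumSymmetrizer_eq_zero (h : IsBraiding r) {i n : ℕ} (hi : i + 1 < n)
    {v : FreeAlgebra K X} (hv : v ∈ tensorDegree K X n) (hneg : braidOp r i v = -v) :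
    quantumSymmetrizer r n v = 0 := by
  obtain ⟨T, hT⟩ := (h.braidRelations n).exists_symmetrizer_eq_mul hi
  have hker : (1 + braidEnd r n i) ⟨v, hv⟩ = 0 := Subtype.ext <| by simp [hneg]
  rw [← coe_symmetrizer_braidEnd r n ⟨v, hv⟩, hT, Module.End.mul_apply, hker, map_zero]
  rfl

end BraidOperators

section QuadraticRelations

open FreeAlgebra (ι)

variable {K : Type*} [Field K]

theorem mkₐ_ringCon_eq_zero_iff {A : Type*} [Ring A] [Algebra K A] {I : TwoSidedIdeal A} {x : A} :
    RingCon.mkₐ K I.ringCon x = 0 ↔ x ∈ I := by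
  refine Iff.trans (TwoSidedIdeal.mem_ker I.ringCon.mk').symm ?_
  rw [TwoSidedIdeal.ker_ringCon_mk']

variable {X : Type*} [Fintype X] {r : X → X → X → X → K}

variable (r) in
theorem quantumSymmetrizer_two : quantumSymmetrizer r 2 = 1 + braidOp r 0 := by
  change symmetrizer (braidOp r) 2 = _
  simp [symmetrizer_succ, Finset.sum_range_succ, descProd_succ]

theorem mem_nicholsRelations_two {v : FreeAlgebra K X} :
    v ∈ nicholsRelations r 2 ↔ v ∈ tensorDegree K X 2 ∧ braidOp r 0 v = -v := by
  simp [nicholsRelations, quantumSymmetrizer_two, eq_neg_iff_add_eq_zero, add_comm]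

theorem nicholsRelations_two_eq_bot {c : K} (hc : c ≠ 1)
    (hsq : ∀ v ∈ tensorDegree K X 2, braidOp r 0 (braidOp r 0 v) = c • v) :
    nicholsRelations r 2 = ⊥ := by
  refine (Submodule.eq_bot_iff _).2 fun v hv => ?_
  obtain ⟨hdeg, hneg⟩ := mem_nicholsRelations_two.1 hv
  have hfix : (1 - c) • v = 0 := by rw [sub_smul, one_smul, ← hsq v hdeg]; simp [hneg]
  exact (smul_eq_zero.1 hfix).resolve_left (sub_ne_zero.2 hc.symm)

theorem IsBraiding.mul_mul_mem_nicholsRelations (h : IsBraiding r) {m n : ℕ}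
    {u v w : FreeAlgebra K X} (hu : u ∈ tensorDegree K X m) (hv : v ∈ nicholsRelations r 2)
    (hw : w ∈ tensorDegree K X n) : u * v * w ∈ nicholsRelations r (m + 2 + n) := by
  obtain ⟨hdeg, hneg⟩ := mem_nicholsRelations_two.1 hv
  have huv : u * v ∈ tensorDegree K X (m + 2) := mul_mem_tensorDegree hu hdeg
  refine ⟨mul_mem_tensorDegree huv hw, h.quantumSymmetrizer_eq_zero (i := m) (by omega)
    (mul_mem_tensorDegree huv hw) ?_⟩
  rw [braidOp_mul_right r (by omega) huv, ← add_zero m, braidOp_mul_left r 0 hu, hneg, mul_neg,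
    neg_mul]

theorem IsBraiding.top_mul_nicholsRelations_two_mul_top_le (h : IsBraiding r) :
    ⊤ * nicholsRelations r 2 * ⊤ ≤ nicholsSubspace r := by
  rw [← iSup_tensorDegree, Submodule.iSup_mul, Submodule.iSup_mul]
  refine iSup_le fun m => ?_
  rw [Submodule.mul_iSup]
  refine iSup_le fun n => ?_
  refine le_trans ?_ (le_iSup₂_of_le (m + 2 + n) (by omega) le_rfl)
  rw [Submodule.mul_le]
  intro x hx w hw
  refine Submodule.mul_induction_on hx (fun u hu v hv => ?_) fun x y hx hy => ?_
  · exact h.mul_mul_mem_nicholsRelations hu hv hw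
  · rw [add_mul]; exact add_mem hx hy

theorem IsBraiding.span_subset_nicholsSubspace (h : IsBraiding r) {S : Set (FreeAlgebra K X)}
    (hS : S ⊆ nicholsRelations r 2) :
    (TwoSidedIdeal.span S : Set (FreeAlgebra K X)) ⊆ nicholsSubspace r := by
  intro x hx
  refine (AddSubgroup.closure_le (nicholsSubspace r).toAddSubgroup).2 ?_
    (TwoSidedIdeal.mem_span_iff_mem_addSubgroup_closure.1 hx)
  rintro _ ⟨_, ⟨u, -, s, hs, rfl⟩, w, -, rfl⟩
  exact h.top_mul_nicholsRelations_two_mul_top_le <| Submodule.mul_mem_mul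
    (Submodule.mul_mem_mul Submodule.mem_top (hS hs)) Submodule.mem_top

variable {A : Type*} [Ring A] [Algebra K A] {φ : FreeAlgebra K X →ₐ[K] A}

/-- `φ : T(V) → A` does not distinguish `v ∈ V ⊗ V` from `c v`, that is, the multiplication of `A`
is commutative with respect to `c` on the image of `V`. -/
def IsBraidedCommutative (r : X → X → X → X → K) (φ : FreeAlgebra K X →ₐ[K] A) : Prop :=
  ∀ x y, φ (braidOp r 0 (ι K x * ι K y)) = φ (ι K x * ι K y)

namespace IsBraidedCommutative

theorem map_braidOp (h : IsBraidedCommutative r φ) (i : ℕ) (u : FreeAlgebra K X) :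
    φ (braidOp r i u) = φ u := by
  have on_words : φ.toLinearMap ∘ₗ braidOp r i = φ.toLinearMap := by
    refine linearMap_ext_wordMonomial fun w => ?_
    simp only [LinearMap.comp_apply, braidOp_wordMonomial, AlgHom.toLinearMap_apply]
    fun_induction braidWord r i w with
    | case1 x y w =>
      have hxy := h x y
      rw [braidOp_zero_ι_mul_ι, map_mul] at hxy
      simp [← mul_assoc, ← hxy, Finset.sum_mul]
    | case2 i x w ih => simp [ih]
    | case3 => rfl
  exact LinearMap.congr_fun on_words u

theorem map_quantumSymmetrizer (h : IsBraidedCommutative r φ) (n : ℕ) (u : FreeAlgebra K X) :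
    φ (quantumSymmetrizer r n u) = n.factorial • φ u := by
  have map_prod (l : List ℕ) : φ ((l.map (braidOp r)).prod u) = φ u := by
    induction l with
    | nil => simp
    | cons i l ih => simpa [h.map_braidOp] using ih
  simp [quantumSymmetrizer, LinearMap.sum_apply, map_prod, Fintype.card_perm]

theorem nicholsSubspace_le_ker [CharZero K] (h : IsBraidedCommutative r φ) :
    nicholsSubspace r ≤ LinearMap.ker φ.toLinearMap := by
  refine iSup₂_le fun n _ v hv => ?_
  have hsmul : (n.factorial : K) • φ v = 0 := by
    rw [Nat.cast_smul_eq_nsmul, ← h.map_quantumSymmetrizer, LinearMap.mem_ker.1 hv.2, map_zero]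
  exact (smul_eq_zero.1 hsmul).resolve_left (Nat.cast_ne_zero.2 n.factorial_ne_zero)

end IsBraidedCommutative

theorem IsBraiding.nicholsSubspace_eq_span [CharZero K] (h : IsBraiding r)
    {S : Set (FreeAlgebra K X)} (hS : S ⊆ nicholsRelations r 2)
    (hcomm : IsBraidedCommutative r (RingCon.mkₐ K (TwoSidedIdeal.span S).ringCon)) :
    (nicholsSubspace r : Set (FreeAlgebra K X)) = TwoSidedIdeal.span S := by
  refine Set.Subset.antisymm (fun v hv => ?_) (h.span_subset_nicholsSubspace hS)
  exact (mkₐ_ringCon_eq_zero_iff (K := K)).1 (hcomm.nicholsSubspace_le_ker hv)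

theorem nicholsIdeal_eq_span {S : Set (FreeAlgebra K X)}
    (h : (nicholsSubspace r : Set (FreeAlgebra K X)) = TwoSidedIdeal.span S) :
    nicholsIdeal r = TwoSidedIdeal.span S := by
  rw [nicholsIdeal, h]
  exact le_antisymm (TwoSidedIdeal.span_le.2 subset_rfl)
    (TwoSidedIdeal.span_mono TwoSidedIdeal.subset_span)

end QuadraticRelations

section Presentation

open FreeAlgebra (ι)

variable {K : Type*} [Field K]

theorem submodule_eq_top_of_mul_mem {A : Type*} [Ring A] [Algebra K A] {s : Set A}
    (hs : Algebra.adjoin K s = ⊤) {N : Submodule K A} (one_mem : 1 ∈ N)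
    (mul_mem : ∀ a ∈ s, ∀ v ∈ N, a * v ∈ N) : N = ⊤ := by
  have stable (a : A) : ∀ v ∈ N, a * v ∈ N := by
    induction (hs ▸ Algebra.mem_top : a ∈ Algebra.adjoin K s) using Algebra.adjoin_induction with
    | mem a ha => exact mul_mem a ha
    | algebraMap c => intro v hv; rw [← Algebra.smul_def]; exact N.smul_mem c hv
    | add a b _ _ ha hb => intro v hv; rw [add_mul]; exact add_mem (ha v hv) (hb v hv)
    | mul a b _ _ ha hb => intro v hv; rw [mul_assoc]; exact ha _ (hb v hv)
  exact Submodule.eq_top_iff'.2 fun a => by simpa using stable a 1 one_mem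

variable {X : Type*} [Fintype X] {r : X → X → X → X → K} {S : Set (FreeAlgebra K X)}

variable (r) in
theorem lift_gen :
    FreeAlgebra.lift K (gen r) = RingCon.mkₐ K (nicholsIdeal r).ringCon := by
  ext i
  simp [gen]

variable (r) in
theorem adjoin_range_gen : Algebra.adjoin K (Set.range (gen r)) = ⊤ := by
  rw [Algebra.adjoin_range_eq_range_freeAlgebra_lift, lift_gen, AlgHom.range_eq_top]
  exact RingCon.mkₐ_surjective _

theorem lift_gen_eq_zero (hS : nicholsIdeal r = TwoSidedIdeal.span S) {s : FreeAlgebra K X}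
    (hs : s ∈ S) : FreeAlgebra.lift K (gen r) s = 0 := by
  rw [lift_gen, mkₐ_ringCon_eq_zero_iff, hS]
  exact TwoSidedIdeal.subset_span hs

theorem exists_algHom_gen (hS : nicholsIdeal r = TwoSidedIdeal.span S) {A : Type*} [Ring A]
    [Algebra K A] {f : X → A} (hf : ∀ s ∈ S, FreeAlgebra.lift K f s = 0) :
    ∃ ψ : NicholsAlgebra r →ₐ[K] A, ∀ i, ψ (gen r i) = f i := by
  have hker : nicholsIdeal r ≤ TwoSidedIdeal.ker (FreeAlgebra.lift K f) := by
    rw [hS, TwoSidedIdeal.span_le]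
    exact fun s hs => (TwoSidedIdeal.mem_ker _).2 (hf s hs)
  exact ⟨RingCon.liftₐ _ (FreeAlgebra.lift K f) (TwoSidedIdeal.ringCon_le_iff.1 hker),
    FreeAlgebra.lift_ι_apply f⟩

end Presentation

section BraidingR16

open FreeAlgebra (ι)

variable {K : Type*} [Field K]

theorem ι_mul_ι_mem {X : Type*} (i j : X) : ι K i * ι K j ∈ tensorDegree K X 2 :=
  Submodule.subset_span ⟨[i, j], rfl, by simp⟩

/-- The values of the braiding of type `R_{1,6}` on the `x_i ⊗ x_j`, with `f m l` in place of
`x_m ⊗ x_l`, so that they may be read in any module. -/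
def braidValue {M : Type*} [AddCommGroup M] [Module K M] (t a b k p q : K)
    (f : Fin 3 → Fin 3 → M) : Fin 3 → Fin 3 → M :=
  ![![t • f 0 0, t • f 1 0 - (t * a) • f 0 0, t • f 2 0 - (t * p) • f 0 0],
    ![t • f 0 1 + (t * a) • f 0 0,
      t • f 1 1 + (t * b) • f 1 0 - (t * b) • f 0 1 - (t * a * b) • f 0 0,
      t • f 2 1 + (t * a) • f 2 0 - (t * p) • f 0 1 + (t * k) • f 0 0],
    ![t • f 0 2 + (t * p) • f 0 0,
      t • f 1 2 + (t * p) • f 1 0 - (t * a) • f 0 2 - (t * (2 * p * a + k)) • f 0 0,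
      t • f 2 2 + (t * q) • f 2 0 - (t * q) • f 0 2 - (t * p * q) • f 0 0]]

variable (t a b k p q : K)

theorem sum_braidingR16_smul {M : Type*} [AddCommGroup M] [Module K M] (f : Fin 3 → Fin 3 → M)
    (i j : Fin 3) :
    ∑ m, ∑ l, braidingR16 t a b k p q i j m l • f m l = braidValue t a b k p q f i j := by
  fin_cases i <;> fin_cases j <;>
    simp [Fin.sum_univ_three, braidingR16, matrixR16, finProdFinEquiv, braidValue] <;> module

theorem braidOp_R16 (i j : Fin 3) :
    braidOp (braidingR16 t a b k p q) 0 (ι K i * ι K j) =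
      braidValue t a b k p q (fun m l => ι K m * ι K l) i j := by
  rw [braidOp_zero_ι_mul_ι, sum_braidingR16_smul]

theorem braidOp_R16_mul (i j : Fin 3) (u : FreeAlgebra K (Fin 3)) :
    braidOp (braidingR16 t a b k p q) 0 (ι K i * (ι K j * u)) =
      braidValue t a b k p q (fun m l => ι K m * (ι K l * u)) i j := by
  rw [← mul_assoc, braidOp_mul_right _ one_lt_two (ι_mul_ι_mem i j), braidOp_zero_ι_mul_ι,
    Finset.sum_mul, ← sum_braidingR16_smul]
  simp only [Finset.sum_mul, smul_mul_assoc, mul_assoc]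

theorem braidOp_R16_braidOp_R16 {v : FreeAlgebra K (Fin 3)} (hv : v ∈ tensorDegree K (Fin 3) 2) :
    braidOp (braidingR16 t a b k p q) 0 (braidOp (braidingR16 t a b k p q) 0 v) = t ^ 2 • v := by
  set c := braidOp (braidingR16 t a b k p q) 0 with hc
  refine eq_of_mem_tensorDegree (f := c * c) (g := t ^ 2 • 1) (fun w hw => ?_) hv
  obtain ⟨i, j, rfl⟩ := List.length_eq_two.1 hw
  fin_cases i <;> fin_cases j <;> simp [hc, braidOp_R16, braidValue] <;> module

theorem braidOp_R16_one_ι_mul (m : Fin 3) (u : FreeAlgebra K (Fin 3)) :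
    braidOp (braidingR16 t a b k p q) 1 (ι K m * u) =
      ι K m * braidOp (braidingR16 t a b k p q) 0 u :=
  braidOp_mul_left _ 0 (by simpa using wordMonomial_mem (K := K) [m]) u

set_option maxHeartbeats 2000000 in
-- both sides are expanded on each of the 27 words of length three
theorem isBraiding_R16 : IsBraiding (braidingR16 t a b k p q) := by
  intro v hv
  refine eq_of_mem_tensorDegree
    (f := braidOp (braidingR16 t a b k p q) 0 * braidOp (braidingR16 t a b k p q) 1 *
      braidOp (braidingR16 t a b k p q) 0)
    (g := braidOp (braidingR16 t a b k p q) 1 * braidOp (braidingR16 t a b k p q) 0 *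
      braidOp (braidingR16 t a b k p q) 1) (fun w hw => ?_) hv
  obtain ⟨i, j, l, rfl⟩ := List.length_eq_three.1 hw
  simp only [wordMonomial, List.map_cons, List.map_nil, List.prod_cons, List.prod_nil, mul_one,
    End.mul_apply]
  fin_cases i <;> fin_cases j <;> fin_cases l <;>
    simp [braidOp_R16_one_ι_mul, braidOp_R16, braidOp_R16_mul, braidValue, mul_add, mul_sub] <;>
    module

theorem relationsNeg_subset_nicholsRelations :
    relationsNeg a b p q ⊆ nicholsRelations (braidingR16 (-1) a b k p q) 2 := by
  simp only [relationsNeg, x₁, x₂, x₃, pow_two]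
  intro s hs
  refine mem_nicholsRelations_two.2 ⟨?_, ?_⟩ <;> rcases hs with rfl | rfl | rfl | rfl | rfl | rfl
  iterate 6 apply_rules [add_mem, sub_mem, Submodule.smul_mem, ι_mul_ι_mem]
  all_goals
    simp only [map_add, map_sub, map_smul, braidOp_R16]
    simp [braidValue] <;> module

theorem relationsPos_subset_nicholsRelations :
    relationsPos a k p ⊆ nicholsRelations (braidingR16 1 a b k p q) 2 := by
  simp only [relationsPos, x₁, x₂, x₃, pow_two]
  intro s hs
  refine mem_nicholsRelations_two.2 ⟨?_, ?_⟩ <;> rcases hs with rfl | rfl | rfl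
  iterate 3 apply_rules [add_mem, sub_mem, Submodule.smul_mem, ι_mul_ι_mem]
  all_goals
    simp only [map_add, map_sub, map_smul, braidOp_R16]
    simp [braidValue]
    module

end BraidingR16

section Relations

open FreeAlgebra (ι)

variable {K : Type*} [Field K] {A : Type*} [Ring A] [Algebra K A]

/-- Elements `x, y, z` of an algebra satisfy the defining relations for `t = -1`, solved for the
products that are not ordered monomials. -/
structure NegRelations (a b p q : K) (x y z : A) : Prop where
  yx : y * x = -(x * y)
  zx : z * x = -(x * z)
  zy : z * y = -(y * z) + a • (x * z) + p • (x * y)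
  xx : x * x = 0
  yy : y * y = b • (x * y)
  zz : z * z = q • (x * z)

/-- Elements `x, y, z` of an algebra satisfy the defining relations for `t = 1`, solved for the
products that are not ordered monomials. -/
structure PosRelations (a k p : K) (x y z : A) : Prop where
  yx : y * x = x * y + a • (x * x)
  zx : z * x = x * z + p • (x * x)
  zy : z * y = y * z - a • (x * z) + p • (x * y) - (k + p * a) • (x * x)

variable {a b k p q : K}

theorem negRelations_iff {f : Fin 3 → A} :
    NegRelations a b p q (f 0) (f 1) (f 2) ↔
      ∀ s ∈ relationsNeg a b p q, FreeAlgebra.lift K f s = 0 := by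
  simp only [relationsNeg, x₁, x₂, x₃, pow_two, Set.forall_mem_insert, Set.mem_singleton_iff,
    forall_eq, map_add, map_sub, map_smul, map_mul, FreeAlgebra.lift_ι_apply]
  refine ⟨fun h => ?_, fun ⟨yx, zx, zy, xx, yy, zz⟩ => ?_⟩
  · simp only [h.yx, h.zx, h.zy, h.xx, h.yy, h.zz]
    refine ⟨?_, ?_, ?_, trivial, ?_, ?_⟩ <;> module
  · exact ⟨eq_neg_of_add_eq_zero_left yx, eq_neg_of_add_eq_zero_left zx,
      by linear_combination (norm := module) zy, xx, sub_eq_zero.1 yy, sub_eq_zero.1 zz⟩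

theorem posRelations_iff {f : Fin 3 → A} :
    PosRelations a k p (f 0) (f 1) (f 2) ↔
      ∀ s ∈ relationsPos a k p, FreeAlgebra.lift K f s = 0 := by
  simp only [relationsPos, x₁, x₂, x₃, pow_two, Set.forall_mem_insert, Set.mem_singleton_iff,
    forall_eq, map_add, map_sub, map_smul, map_mul, FreeAlgebra.lift_ι_apply]
  refine ⟨fun h => ?_, fun ⟨yx, zx, zy⟩ => ?_⟩
  · simp only [h.yx, h.zx, h.zy]
    refine ⟨?_, ?_, ?_⟩ <;> module
  · exact ⟨by linear_combination (norm := module) yx, by linear_combination (norm := module) zx,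
      by linear_combination (norm := module) zy⟩

theorem isBraidedCommutative_of_relationsNeg {φ : FreeAlgebra K (Fin 3) →ₐ[K] A}
    (hφ : ∀ s ∈ relationsNeg a b p q, φ s = 0) :
    IsBraidedCommutative (braidingR16 (-1) a b k p q) φ := by
  have h : NegRelations a b p q (φ (ι K 0)) (φ (ι K 1)) (φ (ι K 2)) :=
    (negRelations_iff (f := φ ∘ ι K)).2 (by simpa only [FreeAlgebra.lift_comp_ι] using hφ)
  intro i j
  rw [braidOp_R16]
  fin_cases i <;> fin_cases j <;>
    simp [braidValue, h.yx, h.zx, h.zy, h.xx, h.yy, h.zz] <;> module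

theorem isBraidedCommutative_of_relationsPos {φ : FreeAlgebra K (Fin 3) →ₐ[K] A}
    (hφ : ∀ s ∈ relationsPos a k p, φ s = 0) :
    IsBraidedCommutative (braidingR16 1 a b k p q) φ := by
  have h : PosRelations a k p (φ (ι K 0)) (φ (ι K 1)) (φ (ι K 2)) :=
    (posRelations_iff (f := φ ∘ ι K)).2 (by simpa only [FreeAlgebra.lift_comp_ι] using hφ)
  intro i j
  rw [braidOp_R16]
  fin_cases i <;> fin_cases j <;>
    simp [braidValue, h.yx, h.zx, h.zy] <;> module

variable [CharZero K] (a b k p q)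

theorem nicholsSubspace_R16_neg :
    (nicholsSubspace (braidingR16 (-1) a b k p q) : Set (FreeAlgebra K (Fin 3))) =
      TwoSidedIdeal.span (relationsNeg a b p q) :=
  (isBraiding_R16 _ a b k p q).nicholsSubspace_eq_span
    (relationsNeg_subset_nicholsRelations a b k p q)
    (isBraidedCommutative_of_relationsNeg fun _ hs =>
      mkₐ_ringCon_eq_zero_iff.2 (TwoSidedIdeal.subset_span hs))

theorem nicholsIdeal_R16_neg :
    nicholsIdeal (braidingR16 (-1) a b k p q) = TwoSidedIdeal.span (relationsNeg a b p q) :=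
  nicholsIdeal_eq_span (nicholsSubspace_R16_neg a b k p q)

theorem negRelations_gen :
    NegRelations a b p q (gen (braidingR16 (-1) a b k p q) 0) (gen _ 1) (gen _ 2) :=
  negRelations_iff.2 fun _ => lift_gen_eq_zero (nicholsIdeal_R16_neg a b k p q)

theorem nicholsSubspace_R16_pos :
    (nicholsSubspace (braidingR16 1 a b k p q) : Set (FreeAlgebra K (Fin 3))) =
      TwoSidedIdeal.span (relationsPos a k p) :=
  (isBraiding_R16 _ a b k p q).nicholsSubspace_eq_span
    (relationsPos_subset_nicholsRelations a b k p q)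
    (isBraidedCommutative_of_relationsPos fun _ hs =>
      mkₐ_ringCon_eq_zero_iff.2 (TwoSidedIdeal.subset_span hs))

theorem nicholsIdeal_R16_pos :
    nicholsIdeal (braidingR16 1 a b k p q) = TwoSidedIdeal.span (relationsPos a k p) :=
  nicholsIdeal_eq_span (nicholsSubspace_R16_pos a b k p q)

theorem posRelations_gen :
    PosRelations a k p (gen (braidingR16 1 a b k p q) 0) (gen _ 1) (gen _ 2) :=
  posRelations_iff.2 fun _ => lift_gen_eq_zero (nicholsIdeal_R16_pos a b k p q)

end Relations

section Monomials

variable {K A M : Type*} [Field K] [Ring A] [Algebra K A] [AddCommGroup M] [Module K M]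

/-- The ordered monomial `x^i y^j z^k` with exponents `e = (i, j, k)`. -/
def pbwMonomial (x y z : A) (e : ℕ × ℕ × ℕ) : A :=
  x ^ e.1 * y ^ e.2.1 * z ^ e.2.2

/-- The ordered monomials `x^i y^j z^k` with `i, j, k < 2`. -/
def truncatedMonomial (x y z : A) (e : Fin 2 × Fin 2 × Fin 2) : A :=
  pbwMonomial x y z (e.1, e.2.1, e.2.2)

theorem map_pbwMonomial {B : Type*} [Ring B] [Algebra K B] (ψ : A →ₐ[K] B) (x y z : A)
    (e : ℕ × ℕ × ℕ) : ψ (pbwMonomial x y z e) = pbwMonomial (ψ x) (ψ y) (ψ z) e := by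
  simp only [pbwMonomial, map_mul, map_pow]

theorem forall_mul_mem_of_span {s : Set A} {N : Submodule K A} {g : A}
    (h : ∀ v ∈ s, g * v ∈ N) : ∀ v ∈ Submodule.span K s, g * v ∈ N :=
  fun _ hv => Submodule.span_le (p := N.comap (LinearMap.mulLeft K g)).2 h hv

theorem linearIndependent_pbwMonomial_gen {r : Fin 3 → Fin 3 → Fin 3 → Fin 3 → K}
    {S : Set (FreeAlgebra K (Fin 3))} (hS : nicholsIdeal r = TwoSidedIdeal.span S)
    {f : Fin 3 → End K M} (hf : ∀ s ∈ S, FreeAlgebra.lift K f s = 0) {I : Type*}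
    {d : I → ℕ × ℕ × ℕ} {m : M}
    (h : LinearIndependent K fun e => pbwMonomial (f 0) (f 1) (f 2) (d e) m) :
    LinearIndependent K fun e => pbwMonomial (gen r 0) (gen r 1) (gen r 2) (d e) := by
  obtain ⟨ψ, hψ⟩ := exists_algHom_gen hS hf
  refine LinearIndependent.of_comp (LinearMap.applyₗ m ∘ₗ ψ.toLinearMap) ?_
  simpa [Function.comp_def, map_pbwMonomial, hψ] using h

theorem adjoin_gen_fin_three (r : Fin 3 → Fin 3 → Fin 3 → Fin 3 → K) :
    Algebra.adjoin K {gen r 0, gen r 1, gen r 2} = ⊤ := by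
  rw [← adjoin_range_gen r]
  congr 1
  ext
  simp [Fin.exists_fin_succ, eq_comm]

end Monomials

section NegativeCase

variable {K : Type*} [Field K] {A : Type*} [Ring A] [Algebra K A] {a b p q : K} {x y z : A}

namespace NegRelations

section

variable (h : NegRelations a b p q x y z) (w : A)
include h

theorem x_mul_x_mul : x * (x * w) = 0 := by
  rw [← mul_assoc, h.xx, zero_mul]

theorem y_mul_x_mul : y * (x * w) = -(x * (y * w)) := by
  rw [← mul_assoc, h.yx, neg_mul, mul_assoc]

theorem y_mul_y_mul : y * (y * w) = b • (x * (y * w)) := by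
  rw [← mul_assoc, h.yy, smul_mul_assoc, mul_assoc]

theorem z_mul_x_mul : z * (x * w) = -(x * (z * w)) := by
  rw [← mul_assoc, h.zx, neg_mul, mul_assoc]

theorem z_mul_y_mul : z * (y * w) = -(y * (z * w)) + a • (x * (z * w)) + p • (x * (y * w)) := by
  rw [← mul_assoc, h.zy]
  simp only [add_mul, neg_mul, smul_mul_assoc, mul_assoc]

end

theorem mul_mem_span (h : NegRelations a b p q x y z) :
    ∀ g ∈ ({x, y, z} : Set A), ∀ v ∈ Submodule.span K (Set.range (truncatedMonomial x y z)),
      g * v ∈ Submodule.span K (Set.range (truncatedMonomial x y z)) := by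
  set N := Submodule.span K (Set.range (truncatedMonomial x y z))
  have mem (e) : truncatedMonomial x y z e ∈ N := Submodule.subset_span ⟨e, rfl⟩
  simp only [truncatedMonomial, pbwMonomial, Prod.forall, Fin.forall_fin_two, Fin.val_zero,
    Fin.val_one, pow_zero, pow_one, one_mul, mul_one, mul_assoc] at mem
  obtain ⟨⟨⟨_, mem_z⟩, mem_y, mem_yz⟩, ⟨mem_x, mem_xz⟩, mem_xy, mem_xyz⟩ := mem
  have x_mul : ∀ v ∈ N, x * v ∈ N := by
    refine forall_mul_mem_of_span (Set.forall_mem_range.2 ?_)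
    simp [truncatedMonomial, pbwMonomial, Prod.forall, Fin.forall_fin_two, mul_assoc,
      h.x_mul_x_mul, h.xx, *]
  have y_mul : ∀ v ∈ N, y * v ∈ N := by
    refine forall_mul_mem_of_span (Set.forall_mem_range.2 ?_)
    simp [truncatedMonomial, pbwMonomial, Prod.forall, Fin.forall_fin_two, mul_assoc,
      h.y_mul_x_mul, h.y_mul_y_mul, h.yx, h.yy, N.smul_mem, *]
  have z_mul : ∀ v ∈ N, z * v ∈ N := by
    refine forall_mul_mem_of_span (Set.forall_mem_range.2 ?_)
    simp (maxDischargeDepth := 4) [truncatedMonomial, pbwMonomial, Prod.forall,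
      Fin.forall_fin_two, mul_assoc, h.x_mul_x_mul, h.y_mul_x_mul, h.z_mul_x_mul, h.z_mul_y_mul,
      h.zx, h.zy, h.zz, N.smul_mem, mul_add, N.add_mem, *]
  simpa using ⟨x_mul, y_mul, z_mul⟩

theorem span_truncatedMonomial (h : NegRelations a b p q x y z)
    (hA : Algebra.adjoin K {x, y, z} = ⊤) :
    Submodule.span K (Set.range (truncatedMonomial x y z)) = ⊤ :=
  submodule_eq_top_of_mul_mem hA
    (Submodule.subset_span ⟨0, by simp [truncatedMonomial, pbwMonomial]⟩) h.mul_mem_span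

end NegRelations

/-- Left multiplication by `x_1` for `t = -1`, in coordinates with respect to the basis
`x_1^i x_2^j x_3^k`, numbered by `4 i + 2 j + k`. -/
def negOp₁ (K : Type*) [Field K] : End K (Fin 8 → K) :=
  let v (i : Fin 8) : (Fin 8 → K) →ₗ[K] K := LinearMap.proj i
  LinearMap.pi ![0, 0, 0, 0, v 0, v 1, v 2, v 3]

/-- Left multiplication by `x_2` for `t = -1`, in the same coordinates as `negOp₁`. -/
def negOp₂ (b : K) : End K (Fin 8 → K) :=
  let v (i : Fin 8) : (Fin 8 → K) →ₗ[K] K := LinearMap.proj i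
  LinearMap.pi ![0, 0, v 0, v 1, 0, 0, b • v 2 - v 4, b • v 3 - v 5]

/-- Left multiplication by `x_3` for `t = -1`, in the same coordinates as `negOp₁`. -/
def negOp₃ (a p q : K) : End K (Fin 8 → K) :=
  let v (i : Fin 8) : (Fin 8 → K) →ₗ[K] K := LinearMap.proj i
  LinearMap.pi ![0, v 0, 0, -v 2, 0, q • v 1 + a • v 2 - v 4, p • v 2, (q + p) • v 3 + v 6]

theorem negRelations_negOp (a b p q : K) :
    NegRelations a b p q (negOp₁ K) (negOp₂ b) (negOp₃ a p q) := by
  constructor <;> refine LinearMap.ext fun v => funext fun i => ?_ <;> fin_cases i <;>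
    simp [negOp₁, negOp₂, negOp₃] <;> ring

theorem truncatedMonomial_negOp_single (a b p q : K) (e : Fin 2 × Fin 2 × Fin 2) :
    truncatedMonomial (negOp₁ K) (negOp₂ b) (negOp₃ a p q) e (Pi.single 0 1) =
      Pi.single ⟨4 * e.1 + 2 * e.2.1 + e.2.2, by omega⟩ 1 := by
  obtain ⟨i, j, k⟩ := e
  refine funext fun m => ?_
  fin_cases i <;> fin_cases j <;> fin_cases k <;> fin_cases m <;>
    simp [truncatedMonomial, pbwMonomial, negOp₁, negOp₂, negOp₃]

theorem linearIndependent_truncatedMonomial_negOp (a b p q : K) :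
    LinearIndependent K fun e =>
      truncatedMonomial (negOp₁ K) (negOp₂ b) (negOp₃ a p q) e (Pi.single 0 1) := by
  have index_injective : Function.Injective fun e : Fin 2 × Fin 2 × Fin 2 =>
      (⟨4 * e.1 + 2 * e.2.1 + e.2.2, by omega⟩ : Fin 8) := by decide
  simpa only [truncatedMonomial_negOp_single, Function.comp_def, Pi.basisFun_apply] using
    (Pi.basisFun K (Fin 8)).linearIndependent.comp _ index_injective

/-- The basis `x_1^i x_2^j x_3^k`, `i, j, k < 2`, of the Nichols algebra for `t = -1`. -/
def basisNeg [CharZero K] (a b k p q : K) :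
    Basis (Fin 2 × Fin 2 × Fin 2) K (NicholsAlgebra (braidingR16 (-1) a b k p q)) :=
  Basis.mk (v := truncatedMonomial (gen _ 0) (gen _ 1) (gen _ 2))
    (linearIndependent_pbwMonomial_gen (nicholsIdeal_R16_neg a b k p q)
      (negRelations_iff (f := ![negOp₁ K, negOp₂ b, negOp₃ a p q]).1 (negRelations_negOp ..))
      (linearIndependent_truncatedMonomial_negOp a b p q))
    ((negRelations_gen a b k p q).span_truncatedMonomial (adjoin_gen_fin_three _)).ge

end NegativeCase

section GKdim

variable {K A : Type*} [Field K] [Ring A] [Algebra K A] {V W : Submodule K A}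

theorem iSup_fin_pow_eq_pow (one_le : 1 ≤ V) (n : ℕ) : ⨆ i : Fin (n + 1), V ^ (i : ℕ) = V ^ n :=
  le_antisymm (iSup_le fun i => pow_le_pow_right' one_le i.is_le)
    (le_iSup (fun i : Fin (n + 1) => V ^ (i : ℕ)) (Fin.last n))

theorem exists_le_pow_of_fg (one_le : 1 ≤ V) (iSup_pow : ⨆ n, V ^ n = ⊤) (hW : W.FG) :
    ∃ d, W ≤ V ^ d := by
  have directed : Directed (· ≤ ·) fun n => V ^ n :=
    Monotone.directed_le fun _ _ h => pow_le_pow_right' one_le h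
  have compact := (CompleteLattice.isCompactElement_iff_le_of_directed_sSup_le _ W).1
    ((Submodule.fg_iff_compact W).1 hW)
  simpa using compact (Set.range fun n => V ^ n) (Set.range_nonempty _)
    directed.directedOn_range (le_top.trans_eq iSup_pow.symm)

theorem iSup_fin_pow_le_pow (one_le : 1 ≤ V) {d : ℕ} (hW : W ≤ V ^ d) (n : ℕ) :
    ⨆ i : Fin (n + 1), W ^ (i : ℕ) ≤ V ^ (d * n) :=
  iSup_le fun i => calc
    W ^ (i : ℕ) ≤ (V ^ d) ^ (i : ℕ) := pow_le_pow_left' hW i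
    _ = V ^ (d * i) := (pow_mul V d i).symm
    _ ≤ V ^ (d * n) := pow_le_pow_right' one_le (Nat.mul_le_mul_left d i.is_le)

theorem tendsto_log_mul_pow_div_log {c : ℝ} (hc : 0 < c) (e : ℕ) :
    Tendsto (fun n : ℕ => ((Real.log (c * n ^ e) / Real.log n : ℝ) : EReal)) atTop (nhds e) := by
  have tendsto_log : Tendsto (fun n : ℕ => Real.log n) atTop atTop :=
    Real.tendsto_log_atTop.comp tendsto_natCast_atTop_atTop
  have tendsto_sum : Tendsto (fun n : ℕ => Real.log c / Real.log n + e) atTop (nhds (e : ℝ)) := by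
    simpa using (tendsto_log.const_div_atTop (Real.log c)).add_const (e : ℝ)
  refine (continuous_coe_real_ereal.tendsto (e : ℝ)).comp (tendsto_sum.congr' ?_)
  filter_upwards [eventually_gt_atTop 1] with n hn
  have log_pos : 0 < Real.log n := Real.log_pos (by exact_mod_cast hn)
  rw [Real.log_mul hc.ne' (by positivity), Real.log_pow, add_div,
    mul_div_cancel_right₀ _ log_pos.ne']

theorem GKdim_nonneg : 0 ≤ GKdim K A := by
  refine le_iSup_of_le ⟨⊥, Submodule.fg_bot⟩ ?_
  refine le_limsup_of_frequently_le (Frequently.of_forall fun n => ?_)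
  exact EReal.coe_nonneg.2 (div_nonneg (Real.log_natCast_nonneg _) (Real.log_natCast_nonneg _))

theorem GKdim_le (hV : V.FG) (one_le : 1 ≤ V) (iSup_pow : ⨆ n, V ^ n = ⊤) {c e : ℕ}
    (h : ∀ n, finrank K ↥(V ^ n) ≤ c * (n + 1) ^ e) : GKdim K A ≤ e := by
  refine iSup_le fun ⟨W, hW⟩ => ?_
  obtain ⟨d, hd⟩ := exists_le_pow_of_fg one_le iSup_pow hW
  have hc : (0 : ℝ) < (c + 1) * (d + 1) ^ e := by positivity
  refine (limsup_le_limsup ?_).trans_eq (tendsto_log_mul_pow_div_log hc e).limsup_eq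
  filter_upwards [eventually_ge_atTop 1] with n hn
  have finrank_le :
      finrank K ↥(⨆ i : Fin (n + 1), W ^ (i : ℕ)) ≤ (c + 1) * (d + 1) ^ e * n ^ e := by
    have : Module.Finite K ↥(V ^ (d * n)) := Module.Finite.iff_fg.2 (hV.pow _)
    calc finrank K ↥(⨆ i : Fin (n + 1), W ^ (i : ℕ)) ≤ finrank K ↥(V ^ (d * n)) :=
          Submodule.finrank_mono (iSup_fin_pow_le_pow one_le hd n)
      _ ≤ c * (d * n + 1) ^ e := h _
      _ ≤ (c + 1) * ((d + 1) * n) ^ e := by gcongr <;> nlinarith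
      _ = (c + 1) * (d + 1) ^ e * n ^ e := by rw [mul_pow, mul_assoc]
  refine EReal.coe_le_coe_iff.2 (div_le_div_of_nonneg_right ?_ (Real.log_natCast_nonneg n))
  rcases Nat.eq_zero_or_pos (finrank K ↥(⨆ i : Fin (n + 1), W ^ (i : ℕ))) with h0 | hpos
  · rw [h0, Nat.cast_zero, Real.log_zero]
    exact_mod_cast Real.log_natCast_nonneg ((c + 1) * (d + 1) ^ e * n ^ e)
  · exact Real.log_le_log (by exact_mod_cast hpos) (by exact_mod_cast finrank_le)

theorem le_GKdim (hV : V.FG) (one_le : 1 ≤ V) {c e : ℕ}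
    (h : ∀ n, n ^ e ≤ c * finrank K ↥(V ^ n)) : e ≤ GKdim K A := by
  refine le_iSup_of_le ⟨V, hV⟩ ?_
  have hc : (0 : ℝ) < c := by
    have := h 1
    exact_mod_cast Nat.pos_of_ne_zero (by rintro rfl; simp at this)
  rw [← (tendsto_log_mul_pow_div_log (inv_pos.2 hc) e).limsup_eq]
  refine limsup_le_limsup ?_
  filter_upwards [eventually_ge_atTop 1] with n hn
  refine EReal.coe_le_coe_iff.2 (div_le_div_of_nonneg_right ?_ (Real.log_natCast_nonneg n))
  refine Real.log_le_log (by positivity) ?_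
  rw [inv_mul_le_iff₀ hc, iSup_fin_pow_eq_pow one_le]
  exact_mod_cast h n

theorem GKdim_eq_zero_of_finite [Module.Finite K A] : GKdim K A = 0 := by
  refine le_antisymm ?_ GKdim_nonneg
  have h (n : ℕ) : finrank K ↥((⊤ : Submodule K A) ^ n) ≤ finrank K A * (n + 1) ^ 0 := by
    simpa using Submodule.finrank_le ((⊤ : Submodule K A) ^ n)
  exact_mod_cast GKdim_le Module.Finite.fg_top le_top (eq_top_iff.2 (le_iSup_of_le 1 (by simp))) h

end GKdim

section Filtration

variable {K A : Type*} [Field K] [Ring A] [Algebra K A]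

section MulPow

variable {F : ℕ → Submodule K A} {g s w : A}

theorem pow_mul_mem (hs : ∀ n, ∀ v ∈ F n, s * v ∈ F (n + 1)) {m : ℕ} (hw : w ∈ F m) (i : ℕ) :
    s ^ i * w ∈ F (m + i) := by
  induction i with
  | zero => simpa using hw
  | succ i ih => rw [pow_succ', mul_assoc]; exact hs _ _ ih

theorem mul_pow_mul_mem (hs : ∀ n, ∀ v ∈ F n, s * v ∈ F (n + 1))
    (hgs : ∀ n, ∀ v ∈ F n, g * v ∈ F (n + 1) → g * (s * v) ∈ F (n + 2)) {m : ℕ} (hw : w ∈ F m)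
    (hgw : g * w ∈ F (m + 1)) (i : ℕ) : g * (s ^ i * w) ∈ F (m + i + 1) := by
  induction i with
  | zero => simpa using hgw
  | succ i ih => rw [pow_succ', mul_assoc]; exact hgs _ _ (pow_mul_mem hs hw i) ih

end MulPow

/-- The span of the ordered monomials `x^i y^j z^k` of total degree at most `m`. -/
def pbwFiltration (K : Type*) {A : Type*} [Field K] [Ring A] [Algebra K A] (x y z : A) (m : ℕ) :
    Submodule K A :=
  Submodule.span K (pbwMonomial x y z '' {e | e.1 + e.2.1 + e.2.2 ≤ m})

variable {a k p : K} {x y z : A}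

theorem pbwMonomial_mem {e : ℕ × ℕ × ℕ} {m : ℕ} (h : e.1 + e.2.1 + e.2.2 ≤ m) :
    pbwMonomial x y z e ∈ pbwFiltration K x y z m :=
  Submodule.subset_span ⟨e, h, rfl⟩

theorem pbwFiltration_mono : Monotone (pbwFiltration K x y z) :=
  fun _ _ h => Submodule.span_mono (Set.image_mono fun _ he => le_trans he h)

theorem iSup_pbwFiltration :
    ⨆ m, pbwFiltration K x y z m = Submodule.span K (Set.range (pbwMonomial x y z)) := by
  refine le_antisymm (iSup_le fun m => Submodule.span_mono (Set.image_subset_range _ _)) ?_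
  exact Submodule.span_le.2 (Set.forall_mem_range.2 fun e =>
    Submodule.mem_iSup_of_mem _ (pbwMonomial_mem le_rfl))

theorem pbwFiltration_le_pow (n : ℕ) :
    pbwFiltration K x y z n ≤ Submodule.span K {1, x, y, z} ^ n := by
  have one_le : 1 ≤ Submodule.span K {1, x, y, z} :=
    Submodule.one_le.2 (Submodule.subset_span (by simp))
  have pow_mem {g : A} (hg : g ∈ ({1, x, y, z} : Set A)) (i : ℕ) :
      g ^ i ∈ Submodule.span K {1, x, y, z} ^ i :=
    Submodule.pow_mem_pow _ (Submodule.subset_span hg) i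
  refine Submodule.span_le.2 (Set.forall_mem_image.2 fun ⟨i, j, l⟩ h => ?_)
  refine pow_le_pow_right' one_le h ?_
  rw [pow_add, pow_add]
  exact Submodule.mul_mem_mul (Submodule.mul_mem_mul (pow_mem (by simp) i) (pow_mem (by simp) j))
    (pow_mem (by simp) l)

theorem finite_setOf_degree_le (m : ℕ) : {e : ℕ × ℕ × ℕ | e.1 + e.2.1 + e.2.2 ≤ m}.Finite := by
  refine (Set.finite_Iic (m, m, m)).subset fun e (he : e.1 + e.2.1 + e.2.2 ≤ m) => ?_
  exact ⟨by dsimp; omega, by dsimp; omega, by dsimp; omega⟩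

instance (m : ℕ) : Module.Finite K (pbwFiltration K x y z m) :=
  Module.Finite.span_of_finite K ((finite_setOf_degree_le m).image _)

theorem finrank_pbwFiltration_le (m : ℕ) :
    finrank K (pbwFiltration K x y z m) ≤ (m + 1) ^ 3 := by
  classical
  let S := Finset.Iic (m, m, m)
  have le_span : pbwFiltration K x y z m ≤ Submodule.span K (S.image (pbwMonomial x y z)) := by
    refine Submodule.span_mono (Set.image_subset_iff.2 fun e (he : _ ≤ m) => ?_)
    refine Finset.mem_coe.2 (Finset.mem_image_of_mem _ (Finset.mem_Iic.2 ?_))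
    exact ⟨by dsimp; omega, by dsimp; omega, by dsimp; omega⟩
  calc finrank K (pbwFiltration K x y z m)
      ≤ finrank K (Submodule.span K (S.image (pbwMonomial x y z) : Set A)) :=
        Submodule.finrank_mono le_span
    _ ≤ (S.image (pbwMonomial x y z)).card := finrank_span_finset_le_card _
    _ ≤ S.card := Finset.card_image_le
    _ = (m + 1) ^ 3 := by
      simp only [S, Finset.card_Iic_prod, Nat.card_Iic]
      ring

theorem le_finrank_pbwFiltration (hli : LinearIndependent K (pbwMonomial x y z)) (m : ℕ) :
    (m / 3 + 1) ^ 3 ≤ finrank K (pbwFiltration K x y z m) := by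
  let d : Fin (m / 3 + 1) × Fin (m / 3 + 1) × Fin (m / 3 + 1) → ℕ × ℕ × ℕ :=
    Prod.map Fin.val (Prod.map Fin.val Fin.val)
  have d_injective : Function.Injective d :=
    Fin.val_injective.prodMap (Fin.val_injective.prodMap Fin.val_injective)
  have mem (e) : pbwMonomial x y z (d e) ∈ pbwFiltration K x y z m :=
    pbwMonomial_mem (by dsimp [d]; omega)
  have linearIndependent :
      LinearIndependent K fun e => (⟨_, mem e⟩ : pbwFiltration K x y z m) :=
    LinearIndependent.of_comp (pbwFiltration K x y z m).subtype (hli.comp d d_injective)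
  calc (m / 3 + 1) ^ 3
      = Fintype.card (Fin (m / 3 + 1) × Fin (m / 3 + 1) × Fin (m / 3 + 1)) := by
        simp only [Fintype.card_prod, Fintype.card_fin]
        ring
    _ ≤ finrank K (pbwFiltration K x y z m) := linearIndependent.fintype_card_le_finrank

theorem mul_mem_pbwFiltration_of_monomial {g : A}
    (h : ∀ i j l, g * (x ^ i * (y ^ j * z ^ l)) ∈ pbwFiltration K x y z (l + j + i + 1)) :
    ∀ m, ∀ v ∈ pbwFiltration K x y z m, g * v ∈ pbwFiltration K x y z (m + 1) := by
  refine fun m => forall_mul_mem_of_span (Set.forall_mem_image.2 fun ⟨i, j, l⟩ hd => ?_)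
  rw [pbwMonomial, mul_assoc]
  exact pbwFiltration_mono (by dsimp at hd; omega) (h i j l)

theorem x_mul_mem_pbwFiltration :
    ∀ m, ∀ v ∈ pbwFiltration K x y z m, x * v ∈ pbwFiltration K x y z (m + 1) := by
  refine mul_mem_pbwFiltration_of_monomial fun i j l => ?_
  rw [← mul_assoc, ← pow_succ', ← mul_assoc]
  exact pbwMonomial_mem (e := (i + 1, j, l)) (by dsimp; omega)

theorem pow_mem_pbwFiltration (l : ℕ) : z ^ l ∈ pbwFiltration K x y z l := by
  simpa [pbwMonomial] using pbwMonomial_mem (K := K) (x := x) (y := y) (z := z)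
    (e := (0, 0, l)) (m := l) (by simp)

theorem pow_mul_pow_mem_pbwFiltration (j l : ℕ) :
    y ^ j * z ^ l ∈ pbwFiltration K x y z (l + j) := by
  simpa [pbwMonomial] using pbwMonomial_mem (K := K) (x := x) (y := y) (z := z)
    (e := (0, j, l)) (m := l + j) (by dsimp; omega)

namespace PosRelations

section

variable (h : PosRelations a k p x y z)
include h

theorem y_mul_mem_pbwFiltration :
    ∀ m, ∀ v ∈ pbwFiltration K x y z m, y * v ∈ pbwFiltration K x y z (m + 1) := by
  have x_mul := x_mul_mem_pbwFiltration (K := K) (x := x) (y := y) (z := z)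
  refine mul_mem_pbwFiltration_of_monomial fun i j l =>
    mul_pow_mul_mem x_mul (fun n v hv hyv => ?_) (pow_mul_pow_mem_pbwFiltration j l) ?_ i
  · have straighten : y * (x * v) = x * (y * v) + a • (x * (x * v)) := by
      rw [← mul_assoc, h.yx]
      simp only [add_mul, smul_mul_assoc, mul_assoc]
    rw [straighten]
    exact add_mem (x_mul _ _ hyv) (Submodule.smul_mem _ a (x_mul _ _ (x_mul _ _ hv)))
  · rw [← mul_assoc, ← pow_succ']
    exact pow_mul_pow_mem_pbwFiltration (j + 1) l

theorem z_mul_mem_pbwFiltration :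
    ∀ m, ∀ v ∈ pbwFiltration K x y z m, z * v ∈ pbwFiltration K x y z (m + 1) := by
  have x_mul := x_mul_mem_pbwFiltration (K := K) (x := x) (y := y) (z := z)
  have y_mul := h.y_mul_mem_pbwFiltration
  refine mul_mem_pbwFiltration_of_monomial fun i j l =>
    mul_pow_mul_mem x_mul (fun n v hv hzv => ?_) (pow_mul_pow_mem_pbwFiltration j l)
      (mul_pow_mul_mem y_mul (fun n v hv hzv => ?_) (pow_mem_pbwFiltration l) ?_ j) i
  · have straighten : z * (x * v) = x * (z * v) + p • (x * (x * v)) := by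
      rw [← mul_assoc, h.zx]
      simp only [add_mul, smul_mul_assoc, mul_assoc]
    rw [straighten]
    exact add_mem (x_mul _ _ hzv) (Submodule.smul_mem _ p (x_mul _ _ (x_mul _ _ hv)))
  · have straighten : z * (y * v) =
        y * (z * v) - a • (x * (z * v)) + p • (x * (y * v)) - (k + p * a) • (x * (x * v)) := by
      rw [← mul_assoc, h.zy]
      simp only [add_mul, sub_mul, smul_mul_assoc, mul_assoc]
    rw [straighten]
    exact sub_mem (add_mem (sub_mem (y_mul _ _ hzv) (Submodule.smul_mem _ a (x_mul _ _ hzv)))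
      (Submodule.smul_mem _ p (x_mul _ _ (y_mul _ _ hv))))
      (Submodule.smul_mem _ (k + p * a) (x_mul _ _ (x_mul _ _ hv)))
  · rw [← pow_succ']
    exact pow_mem_pbwFiltration (l + 1)

theorem mul_mem_pbwFiltration :
    ∀ g ∈ ({x, y, z} : Set A), ∀ m, ∀ v ∈ pbwFiltration K x y z m,
      g * v ∈ pbwFiltration K x y z (m + 1) := by
  simpa using ⟨x_mul_mem_pbwFiltration, h.y_mul_mem_pbwFiltration, h.z_mul_mem_pbwFiltration⟩

theorem pow_le_pbwFiltration (n : ℕ) :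
    Submodule.span K {1, x, y, z} ^ n ≤ pbwFiltration K x y z n := by
  induction n with
  | zero =>
    rw [pow_zero, Submodule.one_le]
    simpa using pow_mem_pbwFiltration (K := K) (x := x) (y := y) (z := z) 0
  | succ n ih =>
    rw [pow_succ']
    refine Submodule.mul_le.2 fun g hg v hv => ?_
    refine (Submodule.span_le (p := (pbwFiltration K x y z (n + 1)).comap
      (LinearMap.mulRight K v))).2 ?_ hg
    rintro g (rfl | hg)
    · simpa using pbwFiltration_mono n.le_succ (ih hv)
    · exact h.mul_mem_pbwFiltration g hg n v (ih hv)

theorem pow_eq_pbwFiltration (n : ℕ) :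
    Submodule.span K {1, x, y, z} ^ n = pbwFiltration K x y z n :=
  (h.pow_le_pbwFiltration n).antisymm (pbwFiltration_le_pow n)

theorem span_pbwMonomial (hA : Algebra.adjoin K {x, y, z} = ⊤) :
    Submodule.span K (Set.range (pbwMonomial x y z)) = ⊤ := by
  refine submodule_eq_top_of_mul_mem hA
    (Submodule.subset_span ⟨0, by simp [pbwMonomial]⟩) fun g hg => ?_
  refine forall_mul_mem_of_span (Set.forall_mem_range.2 fun e => ?_)
  rw [← iSup_pbwFiltration]
  exact Submodule.mem_iSup_of_mem _ (h.mul_mem_pbwFiltration g hg _ _ (pbwMonomial_mem le_rfl))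

theorem GKdim_eq_three (hA : Algebra.adjoin K {x, y, z} = ⊤)
    (hli : LinearIndependent K (pbwMonomial x y z)) : GKdim K A = 3 := by
  have fg : (Submodule.span K {1, x, y, z}).FG := Submodule.fg_span (by simp)
  have one_le : 1 ≤ Submodule.span K {1, x, y, z} :=
    Submodule.one_le.2 (Submodule.subset_span (by simp))
  have iSup_pow : ⨆ n, Submodule.span K {1, x, y, z} ^ n = ⊤ := by
    simp only [h.pow_eq_pbwFiltration, iSup_pbwFiltration, h.span_pbwMonomial hA]
  refine le_antisymm (GKdim_le (c := 1) (e := 3) fg one_le iSup_pow fun n => ?_)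
    (le_GKdim (c := 27) (e := 3) fg one_le fun n => ?_) <;> rw [h.pow_eq_pbwFiltration]
  · simpa using finrank_pbwFiltration_le n
  · calc n ^ 3 ≤ (3 * (n / 3 + 1)) ^ 3 := Nat.pow_le_pow_left (by omega) 3
      _ = 27 * (n / 3 + 1) ^ 3 := by ring
      _ ≤ 27 * finrank K (pbwFiltration K x y z n) :=
        Nat.mul_le_mul_left 27 (le_finrank_pbwFiltration hli n)

end

end PosRelations

end Filtration

section PositiveCase

variable {K : Type*} [Field K]

theorem linearIndependent_of_unitriangular {ι : Type*} {f : ι → ι →₀ K} (height : ι → ℕ)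
    (hf : ∀ i j, height j ≤ height i → f i j = Finsupp.single i 1 j) :
    LinearIndependent K f := by
  classical
  refine linearIndependent_iff.2 fun l hl => by_contra fun hne => ?_
  obtain ⟨j, hj, hmin⟩ :=
    Finset.exists_min_image l.support height (Finsupp.support_nonempty_iff.2 hne)
  have coeff_zero := DFunLike.congr_fun hl j
  rw [Finsupp.linearCombination_apply, Finsupp.sum, Finsupp.finsetSum_apply,
    Finset.sum_eq_single_of_mem j hj] at coeff_zero
  · rw [Finsupp.smul_apply, hf j j le_rfl, Finsupp.single_eq_same, smul_eq_mul, mul_one,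
      Finsupp.zero_apply] at coeff_zero
    exact Finsupp.mem_support_iff.1 hj coeff_zero
  · intro i hi hij
    rw [Finsupp.smul_apply, hf i j (hmin i hi), Finsupp.single_eq_of_ne hij.symm, smul_zero]

/-- The monomial `X^i Y^j Z^l` of `K[X, Y, Z]`, with polynomials encoded as finitely supported
functions of the exponents. -/
def vec (K : Type*) [Field K] (i j l : ℕ) : ℕ × ℕ × ℕ →₀ K := Finsupp.single (i, j, l) 1

/-- The action of `x_1` for `t = 1` on polynomials: multiplication by `X`. -/
def posOp₁ (K : Type*) [Field K] : End K (ℕ × ℕ × ℕ →₀ K) :=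
  Finsupp.linearCombination K fun e => vec K (e.1 + 1) e.2.1 e.2.2

/-- The action of `x_2` for `t = 1` on polynomials: `Y + a X (X ∂_X + Y ∂_Y + Z ∂_Z)`. -/
def posOp₂ (a : K) : End K (ℕ × ℕ × ℕ →₀ K) :=
  Finsupp.linearCombination K fun e => vec K e.1 (e.2.1 + 1) e.2.2 +
    (a * (e.1 + e.2.1 + e.2.2)) • vec K (e.1 + 1) e.2.1 e.2.2

/-- The action of `x_3` for `t = 1` on polynomials:
`Z + p X (X ∂_X + Y ∂_Y) - (k + p a) X² ∂_Y`. The truncated exponent `j - 1` of the last term only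
matters for `j = 0`, where its coefficient vanishes. -/
def posOp₃ (a k p : K) : End K (ℕ × ℕ × ℕ →₀ K) :=
  Finsupp.linearCombination K fun e => vec K e.1 e.2.1 (e.2.2 + 1) +
    (p * (e.1 + e.2.1)) • vec K (e.1 + 1) e.2.1 e.2.2 -
    ((k + p * a) * e.2.1) • vec K (e.1 + 2) (e.2.1 - 1) e.2.2

theorem posOp₁_vec (i j l : ℕ) : posOp₁ K (vec K i j l) = vec K (i + 1) j l := by
  rw [posOp₁, vec, Finsupp.linearCombination_single, one_smul]

theorem posOp₂_vec (a : K) (i j l : ℕ) : posOp₂ a (vec K i j l) =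
    vec K i (j + 1) l + (a * (i + j + l)) • vec K (i + 1) j l := by
  rw [posOp₂, vec, Finsupp.linearCombination_single, one_smul]

theorem posOp₃_vec (a k p : K) (i j l : ℕ) : posOp₃ a k p (vec K i j l) =
    vec K i j (l + 1) + (p * (i + j)) • vec K (i + 1) j l -
      ((k + p * a) * j) • vec K (i + 2) (j - 1) l := by
  rw [posOp₃, vec, Finsupp.linearCombination_single, one_smul]

theorem end_ext_vec {f g : End K (ℕ × ℕ × ℕ →₀ K)}
    (h : ∀ i j l, f (vec K i j l) = g (vec K i j l)) : f = g :=
  Finsupp.lhom_ext' fun e => LinearMap.ext_ring (h e.1 e.2.1 e.2.2)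

theorem posRelations_posOp (a k p : K) :
    PosRelations a k p (posOp₁ K) (posOp₂ a) (posOp₃ a k p) := by
  constructor <;> refine end_ext_vec fun i j l => ?_
  · simp only [posOp₁_vec, posOp₂_vec, End.mul_apply, LinearMap.add_apply, LinearMap.smul_apply,
      map_add, map_smul, Nat.cast_add, Nat.cast_one]
    module
  · simp only [posOp₁_vec, posOp₃_vec, End.mul_apply, LinearMap.add_apply, LinearMap.smul_apply,
      map_add, map_sub, map_smul, Nat.cast_add, Nat.cast_one]
    module
  · rcases j with _ | j <;>
      simp only [posOp₁_vec, posOp₂_vec, posOp₃_vec, End.mul_apply, LinearMap.add_apply,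
        LinearMap.sub_apply, LinearMap.smul_apply, map_add, map_sub, map_smul, Nat.cast_add,
        Nat.cast_one, Nat.cast_zero, Nat.add_sub_cancel, Nat.cast_ofNat] <;>
      module

/-- The polynomials divisible by `X^m`. -/
def xAdic (K : Type*) [Field K] (m : ℕ) : Submodule K (ℕ × ℕ × ℕ →₀ K) :=
  Finsupp.supported K K {e | m ≤ e.1}

theorem vec_mem_xAdic {m i : ℕ} (j l : ℕ) (h : m ≤ i) : vec K i j l ∈ xAdic K m :=
  Finsupp.single_mem_supported K 1 h

theorem map_mem_xAdic {f : End K (ℕ × ℕ × ℕ →₀ K)} {m n : ℕ}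
    (h : ∀ i j l, m ≤ i → f (vec K i j l) ∈ xAdic K n) {v : ℕ × ℕ × ℕ →₀ K}
    (hv : v ∈ xAdic K m) : f v ∈ xAdic K n := by
  rw [xAdic, Finsupp.supported_eq_span_single] at hv
  exact (Submodule.span_le (p := (xAdic K n).comap f)).2
    (Set.forall_mem_image.2 fun e he => h e.1 e.2.1 e.2.2 he) hv

theorem posOp₁_pow_mem_xAdic {m : ℕ} (i : ℕ) {v : ℕ × ℕ × ℕ →₀ K} (hv : v ∈ xAdic K m) :
    (posOp₁ K ^ i) v ∈ xAdic K (m + i) := by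
  induction i with
  | zero => simpa using hv
  | succ i ih =>
    rw [pow_succ', End.mul_apply]
    refine map_mem_xAdic (fun i' j l h => ?_) ih
    rw [posOp₁_vec]
    exact vec_mem_xAdic _ _ (by omega)

theorem posOp₂_mem_xAdic (a : K) {m : ℕ} {v : ℕ × ℕ × ℕ →₀ K} (hv : v ∈ xAdic K m) :
    posOp₂ a v ∈ xAdic K m := by
  refine map_mem_xAdic (fun i j l h => ?_) hv
  rw [posOp₂_vec]
  exact add_mem (vec_mem_xAdic _ _ h) (Submodule.smul_mem _ _ (vec_mem_xAdic _ _ (by omega)))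

theorem posOp₁_pow_vec (i j l : ℕ) : (posOp₁ K ^ i) (vec K 0 j l) = vec K i j l := by
  induction i with
  | zero => rw [pow_zero, End.one_apply]
  | succ i ih => rw [pow_succ', End.mul_apply, ih, posOp₁_vec]

theorem posOp₃_pow_vec (a k p : K) (l : ℕ) :
    (posOp₃ a k p ^ l) (vec K 0 0 0) = vec K 0 0 l := by
  induction l with
  | zero => rw [pow_zero, End.one_apply]
  | succ l ih => rw [pow_succ', End.mul_apply, ih, posOp₃_vec]; simp

theorem posOp₂_pow_vec_sub_mem_xAdic (a : K) (j l : ℕ) :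
    (posOp₂ a ^ j) (vec K 0 0 l) - vec K 0 j l ∈ xAdic K 1 := by
  induction j with
  | zero => simp
  | succ j ih =>
    have posOp₂_pow_succ_vec : (posOp₂ a ^ (j + 1)) (vec K 0 0 l) - vec K 0 (j + 1) l =
        posOp₂ a ((posOp₂ a ^ j) (vec K 0 0 l) - vec K 0 j l) +
          (a * ((0 : ℕ) + j + l)) • vec K 1 j l := by
      rw [pow_succ', End.mul_apply, map_sub, posOp₂_vec]
      abel
    rw [posOp₂_pow_succ_vec]
    exact add_mem (posOp₂_mem_xAdic a ih) (Submodule.smul_mem _ _ (vec_mem_xAdic j l le_rfl))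

theorem pbwMonomial_posOp_vec_sub_mem_xAdic (a k p : K) (e : ℕ × ℕ × ℕ) :
    pbwMonomial (posOp₁ K) (posOp₂ a) (posOp₃ a k p) e (vec K 0 0 0) - Finsupp.single e 1 ∈
      xAdic K (e.1 + 1) := by
  have mem := posOp₁_pow_mem_xAdic e.1 (posOp₂_pow_vec_sub_mem_xAdic a e.2.1 e.2.2)
  rw [map_sub, posOp₁_pow_vec, add_comm 1] at mem
  rwa [pbwMonomial, End.mul_apply, End.mul_apply, posOp₃_pow_vec]

theorem linearIndependent_pbwMonomial_posOp (a k p : K) :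
    LinearIndependent K fun e =>
      pbwMonomial (posOp₁ K) (posOp₂ a) (posOp₃ a k p) e (vec K 0 0 0) := by
  refine linearIndependent_of_unitriangular (fun e => e.1) fun e e' h => ?_
  have support_subset :=
    (Finsupp.mem_supported K _).1 (pbwMonomial_posOp_vec_sub_mem_xAdic a k p e)
  rw [← sub_eq_zero, ← Finsupp.sub_apply, ← Finsupp.notMem_support_iff]
  exact fun he' => absurd (support_subset he') (Nat.not_le.2 (Nat.lt_succ_of_le h))

variable [CharZero K] (a b k p q : K)

theorem linearIndependent_pbwMonomial_R16_pos :
    LinearIndependent K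
      (pbwMonomial (gen (braidingR16 1 a b k p q) 0) (gen _ 1) (gen _ 2)) :=
  linearIndependent_pbwMonomial_gen (d := id) (nicholsIdeal_R16_pos a b k p q)
    (posRelations_iff (f := ![posOp₁ K, posOp₂ a, posOp₃ a k p]).1 (posRelations_posOp a k p))
    (linearIndependent_pbwMonomial_posOp a k p)

/-- The PBW basis `x_1^i x_2^j x_3^l` of the Nichols algebra for `t = 1`. -/
def basisPos : Basis (ℕ × ℕ × ℕ) K (NicholsAlgebra (braidingR16 1 a b k p q)) :=
  Basis.mk (linearIndependent_pbwMonomial_R16_pos a b k p q)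
    ((posRelations_gen a b k p q).span_pbwMonomial (adjoin_gen_fin_three _)).ge

end PositiveCase

end NicholsR16

end

open NicholsR16 in
theorem proposition3p12_general {K : Type*} [Field K] [CharZero K] (t a b k p q : K) :
    (t ^ 2 ≠ 1 → nicholsRelations (braidingR16 t a b k p q) 2 = ⊥) ∧
    (t = -1 →
      (nicholsSubspace (braidingR16 t a b k p q) : Set (FreeAlgebra K (Fin 3))) =
          TwoSidedIdeal.span (relationsNeg a b p q) ∧
      (∃ B : Module.Basis (Fin 2 × Fin 2 × Fin 2) K (NicholsAlgebra (braidingR16 t a b k p q)),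
        ∀ e, B e = gen (braidingR16 t a b k p q) 0 ^ (e.1 : ℕ) *
          gen (braidingR16 t a b k p q) 1 ^ (e.2.1 : ℕ) *
          gen (braidingR16 t a b k p q) 2 ^ (e.2.2 : ℕ)) ∧
      Module.finrank K (NicholsAlgebra (braidingR16 t a b k p q)) = 8 ∧
      GKdim K (NicholsAlgebra (braidingR16 t a b k p q)) = 0) ∧
    (t = 1 →
      (nicholsSubspace (braidingR16 t a b k p q) : Set (FreeAlgebra K (Fin 3))) =
          TwoSidedIdeal.span (relationsPos a k p) ∧
      (∃ B : Module.Basis (ℕ × ℕ × ℕ) K (NicholsAlgebra (braidingR16 t a b k p q)),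
        ∀ e, B e = gen (braidingR16 t a b k p q) 0 ^ e.1 *
          gen (braidingR16 t a b k p q) 1 ^ e.2.1 *
          gen (braidingR16 t a b k p q) 2 ^ e.2.2) ∧
      GKdim K (NicholsAlgebra (braidingR16 t a b k p q)) = 3) := by
  refine ⟨fun ht => nicholsRelations_two_eq_bot ht fun _ => braidOp_R16_braidOp_R16 t a b k p q,
    ?_, ?_⟩
  · rintro rfl
    let B := basisNeg a b k p q
    have : Module.Finite K (NicholsAlgebra (braidingR16 (-1) a b k p q)) := .of_basis B
    exact ⟨nicholsSubspace_R16_neg a b k p q, ⟨B, Basis.mk_apply _ _⟩,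
      (finrank_eq_card_basis B).trans (by simp), GKdim_eq_zero_of_finite⟩
  · rintro rfl
    exact ⟨nicholsSubspace_R16_pos a b k p q, ⟨basisPos a b k p q, Basis.mk_apply _ _⟩,
      (posRelations_gen a b k p q).GKdim_eq_three (adjoin_gen_fin_three _)
        (linearIndependent_pbwMonomial_R16_pos a b k p q)⟩

open NicholsR16 in
theorem proposition3p12 {K : Type*} [Field K] [IsAlgClosed K] [CharZero K]
    (t a b k p q : K) (ht : t ≠ 0) :
    -- if `t² ≠ 1`, there are no quadratic relations
    (t ^ 2 ≠ 1 → nicholsRelations (braidingR16 t a b k p q) 2 = ⊥) ∧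
    -- `t = -1`
    (t = -1 →
      (nicholsSubspace (braidingR16 t a b k p q) : Set (FreeAlgebra K (Fin 3))) =
          TwoSidedIdeal.span (relationsNeg a b p q) ∧
      (∃ B : Module.Basis (Fin 2 × Fin 2 × Fin 2) K (NicholsAlgebra (braidingR16 t a b k p q)),
        ∀ e, B e = gen (braidingR16 t a b k p q) 0 ^ (e.1 : ℕ) *
          gen (braidingR16 t a b k p q) 1 ^ (e.2.1 : ℕ) *
          gen (braidingR16 t a b k p q) 2 ^ (e.2.2 : ℕ)) ∧
      Module.finrank K (NicholsAlgebra (braidingR16 t a b k p q)) = 8 ∧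
      GKdim K (NicholsAlgebra (braidingR16 t a b k p q)) = 0) ∧
    -- `t = 1`
    (t = 1 →
      (nicholsSubspace (braidingR16 t a b k p q) : Set (FreeAlgebra K (Fin 3))) =
          TwoSidedIdeal.span (relationsPos a k p) ∧
      (∃ B : Module.Basis (ℕ × ℕ × ℕ) K (NicholsAlgebra (braidingR16 t a b k p q)),
        ∀ e, B e = gen (braidingR16 t a b k p q) 0 ^ e.1 *
          gen (braidingR16 t a b k p q) 1 ^ e.2.1 *
          gen (braidingR16 t a b k p q) 2 ^ e.2.2) ∧
      GKdim K (NicholsAlgebra (braidingR16 t a b k p q)) = 3) :=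
  proposition3p12_general t a b k p q
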